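/- Let $(M,J,g)$ and $(\widetilde M,\tilde J,\tilde g)$ be smooth almost Hermitian manifolds of real dimensions $2m$ and $2n$: $J$ is a smooth almost complex structure and $g$ a smooth $J$-invariant Riemannian metric, and likewise for $\widetilde M$. Extend $g$ complex-bilinearly to $TM\otimes\mathbb C$, let $T'M$ be the $\sqrt{-1}$-eigenbundle of $J$, and put $|X|^2=g(X,\overline X)$ for $X\in T'M$. Let $\nabla$ be the canonical connection of $M$, i.e. the affine connection with $\nabla J=0$, $\nabla g=0$ and torsion with vanishing $(1,1)$-part, and let $R(X,Y)=[\nabla_X,\nabla_Y]-\nabla_{[X,Y]}$ be its curvature, extended complex-multilinearly. In a unitary frame $e_1,\dots,e_m$ of $T'_xM$ (that is, $g(e_i,\overline{e_j})=\delta_{ij}$) write $R^{j}_{ik\bar\ell}=g(R(e_k,\overline{e_\ell})e_i,\overline{e_j})$. For nonzero $X,Y\in T'_xM$ define $$HB(X,Y)=\frac{R^{j}_{ik\bar\ell}X^i\overline{X^j}Y^k\overline{Y^\ell}}{|X|^2|Y|^2},\qquad HS(X)=HB(X,X),$$ and define the first and second Ricci curvatures $Ric'_M$, $Ric''_M$ and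 the scalar curvature $R$ by $$R'_{k\bar\ell}=\sum_i R^{i}_{ik\bar\ell},\qquad R''_{k\bar\ell}=\sum_i R^{\ell}_{ki\bar i},\qquad R=\sum_{i,j}R^{i}_{ij\bar j}.$$ The holomorphic bisectional curvature $HB_{\widetilde M}$ is defined in the same way from the canonical connection of $\widetilde M$. Let $B\in\mathbb R$ and suppose that $HB_{\widetilde M}\le B$, i.e. $HB_{\widetilde M}(X,Y)\le B$ for all nonzero $(1,0)$-vectors $X,Y$ at every point of $\widetilde M$. Let $f:M\to\widetilde M$ be a pseudoholomorphic isometry, i.e. a smooth map with $df\circ J=\tilde J\circ df$ and $f^*\tilde g=g$. Then at every point of $M$: (1) the Hermitian forms $Ric'_M-mBg$ and $Ric''_M-mBg$ on $T'M$ are negative semi-definite, i.e. $R'_{k\bar\ell}X^k\overline{X^\ell}\le mB|X|^2$ and $R''_{k\bar\ell}X^k\overline{X^\ell}\le mB|X|^2$ for all $X\in T'M$; (2) $R\le m^2B$; (3) $HS_M(X)\le B$ for every nonzero $X\in T'M$. -/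

import Mathlib

open Bundle
open scoped Manifold ContDiff Topology TensorProduct ComplexOrder ComplexConjugate

noncomputable section

set_option linter.unusedSectionVars false

namespace AlmostHermitian

/-! ### Complexification of a real vector space -/

section Complexification

variable (V : Type*) [AddCommGroup V] [Module ℝ V]

/-- Complex conjugation `z ⊗ v ↦ z̄ ⊗ v` on the complexification `ℂ ⊗ V`. -/
def conjC : (ℂ ⊗[ℝ] V) →ₗ[ℝ] (ℂ ⊗[ℝ] V) :=
  Complex.conjAe.toLinearMap.rTensor V

variable {V}

/-- The `ℂ`-trilinear extension to `ℂ ⊗ V` of an `ℝ`-trilinear map `V × V × V → V`. -/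
def complexify₃ (R : V →ₗ[ℝ] V →ₗ[ℝ] V →ₗ[ℝ] V) (X Y : ℂ ⊗[ℝ] V) :
    (ℂ ⊗[ℝ] V) →ₗ[ℂ] (ℂ ⊗[ℝ] V) :=
  (LinearMap.baseChangeHom ℝ ℂ V V).liftBaseChange ℂ (LinearMap.BilinMap.baseChange ℂ R X Y)

theorem complexify₃_tmul (R : V →ₗ[ℝ] V →ₗ[ℝ] V →ₗ[ℝ] V) (a b c : ℂ) (u v w : V) :
    complexify₃ R (a ⊗ₜ u) (b ⊗ₜ v) (c ⊗ₜ w) = (a * b * c) ⊗ₜ R u v w := by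
  simp [complexify₃, TensorProduct.smul_tmul']

end Complexification

/-! ### The curvature tensor of a smooth connection on the tangent bundle -/

section Curvature

variable {E : Type*} [NormedAddCommGroup E] [NormedSpace ℝ E] [FiniteDimensional ℝ E]
  [CompleteSpace E]
  {M : Type*} [TopologicalSpace M] [T2Space M] [ChartedSpace E M] [IsManifold 𝓘(ℝ, E) ∞ M]

/-- If `D` is a smooth connection, `σ` is a smooth vector field near `x` and `Y` is differentiable
at `x`, then `∇_Y σ` is differentiable at `x`. -/
theorem mdiffAt_cov
    (D : CovariantDerivative 𝓘(ℝ, E) E (TangentSpace 𝓘(ℝ, E) : M → Type _))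
    [hD : D.ContMDiffCovariantDerivative ∞] {x : M} {σ Y : Π y : M, TangentSpace 𝓘(ℝ, E) y}
    {s : Set M} (hs : s ∈ 𝓝 x)
    (hσ : CMDiff[s] ∞ (T% σ)) (hY : MDiffAt (T% Y) x) :
    MDiffAt (T% fun y ↦ D σ y (Y y)) x := by
  obtain ⟨f, -, hf⟩ := (SmoothBumpFunction.nhds_basis_tsupport (I := 𝓘(ℝ, E)) x).mem_iff.1
    (interior_mem_nhds.2 hs)
  have h1 : CMDiff ∞ (T% ((f : M → ℝ) • σ)) :=
    ContMDiffOn.smul_section_of_tsupport f.contMDiff.contMDiffOn isOpen_interior hf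
      (hσ.mono interior_subset)
  have h2 := hD.contMDiff.contMDiff (σ := (f : M → ℝ) • σ) (by simpa using! h1.contMDiffOn)
  have h3 := (h2 x trivial).contMDiffAt Filter.univ_mem
  have h4 := MDifferentiableAt.clm_bundle_apply (h3.mdifferentiableAt (by simp)) hY
  refine h4.congr_of_eventuallyEq ?_
  have h5 : ∀ᶠ y in 𝓝 x, ∀ᶠ z in 𝓝 y, z ∈ interior s ∧ f z = 1 :=
    (Filter.Eventually.and
      (isOpen_interior.mem_nhds (mem_interior_iff_mem_nhds.2 hs))
      f.eventuallyEq_one).eventually_nhds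
  filter_upwards [h5] with y hy
  have hyy := hy.self_of_nhds
  have e : D σ y = D ((f : M → ℝ) • σ) y := by
    refine D.isCovariantDerivativeOnUniv.congr_of_eventuallyEq (s := Set.univ) ?_ ?_
      Filter.univ_mem ?_
    · exact (hσ.contMDiffAt (mem_interior_iff_mem_nhds.1 hyy.1)).mdifferentiableAt (by simp)
    · exact (h1 y).mdifferentiableAt (by simp)
    · filter_upwards [hy] with z hz
      simp [hz.2]
  simp [e]


/-- `R(X, Y)Z = ∇_X ∇_Y Z - ∇_Y ∇_X Z - ∇_{[X, Y]} Z` for vector fields `X`, `Y`, `Z`. -/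
def curvatureField (D : CovariantDerivative 𝓘(ℝ, E) E (TangentSpace 𝓘(ℝ, E) : M → Type _))
    (X Y Z : Π y : M, TangentSpace 𝓘(ℝ, E) y) (x : M) : TangentSpace 𝓘(ℝ, E) x :=
  D (fun y ↦ D Z y (Y y)) x (X x) - D (fun y ↦ D Z y (X y)) x (Y x) -
    D Z x (VectorField.mlieBracket 𝓘(ℝ, E) X Y x)

/-- The extension of a tangent vector at `x` to a vector field which is constant in the preferred
chart at `x` on the domain of this chart (and zero outside of it). -/
def ext {x : M} (v : TangentSpace 𝓘(ℝ, E) x) (y : M) : TangentSpace 𝓘(ℝ, E) y :=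
  (trivializationAt E (TangentSpace 𝓘(ℝ, E)) x).symmₗ ℝ y
    ((trivializationAt E (TangentSpace 𝓘(ℝ, E)) x).linearMapAt ℝ x v)

theorem ext_add {x : M} (v w : TangentSpace 𝓘(ℝ, E) x) : ext (v + w) = ext v + ext w := by
  ext y
  simp only [ext, map_add, Pi.add_apply]

theorem ext_smul {x : M} (c : ℝ) (v : TangentSpace 𝓘(ℝ, E) x) : ext (c • v) = c • ext v := by
  ext y
  simp only [ext, map_smul, Pi.smul_apply]

theorem ext_self {x : M} (v : TangentSpace 𝓘(ℝ, E) x) : ext v x = v :=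
  (trivializationAt E (TangentSpace 𝓘(ℝ, E)) x).symmₗ_linearMapAt
    (FiberBundle.mem_baseSet_trivializationAt' x) v

theorem exists_contMDiffOn_ext {x : M} (v : TangentSpace 𝓘(ℝ, E) x) :
    ∃ s ∈ 𝓝 x, CMDiff[s] ∞ (T% (ext v)) := by
  obtain ⟨s, hs, h⟩ := FiberBundle.exists_contMDiffOn_extend (k := ∞) 𝓘(ℝ, E) E v
  have hx := FiberBundle.mem_baseSet_trivializationAt' (F := E) (E := TangentSpace 𝓘(ℝ, E)) x
  refine ⟨s ∩ (trivializationAt E (TangentSpace 𝓘(ℝ, E)) x).baseSet, Filter.inter_mem hs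
    ((trivializationAt E (TangentSpace 𝓘(ℝ, E)) x).open_baseSet.mem_nhds hx),
    (h.mono Set.inter_subset_left).congr fun y hy ↦ ?_⟩
  simp only [ext, FiberBundle.extend, Trivialization.coe_linearMapAt_of_mem _ hx]
  rw [Trivialization.symmₗ_apply (hb := hy.2)]

theorem eventually_mdiffAt_ext {x : M} (v : TangentSpace 𝓘(ℝ, E) x) :
    ∀ᶠ y in 𝓝 x, MDiffAt (T% (ext v)) y := by
  obtain ⟨s, hs, h⟩ := exists_contMDiffOn_ext v
  filter_upwards [eventually_mem_nhds_iff.2 hs] with y hy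
  exact (h.contMDiffAt hy).mdifferentiableAt (by simp)

theorem mdiffAt_ext {x : M} (v : TangentSpace 𝓘(ℝ, E) x) : MDiffAt (T% (ext v)) x :=
  (eventually_mdiffAt_ext v).self_of_nhds

section

variable (D : CovariantDerivative 𝓘(ℝ, E) E (TangentSpace 𝓘(ℝ, E) : M → Type _))
  [D.ContMDiffCovariantDerivative ∞]

theorem mdiffAt_cov_ext {x : M} (v w : TangentSpace 𝓘(ℝ, E) x) :
    MDiffAt (T% fun y ↦ D (ext w) y (ext v y)) x := by
  obtain ⟨s, hs, h⟩ := exists_contMDiffOn_ext w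
  exact mdiffAt_cov D hs h (mdiffAt_ext v)

theorem curvatureField_swap (X Y Z : Π y : M, TangentSpace 𝓘(ℝ, E) y) (x : M) :
    curvatureField D X Y Z x = -curvatureField D Y X Z x := by
  simp only [curvatureField]
  rw [VectorField.mlieBracket_swap_apply]
  simp only [map_neg]
  abel

theorem curvatureField_ext_add_left {x : M} (u u' v w : TangentSpace 𝓘(ℝ, E) x) :
    curvatureField D (ext (u + u')) (ext v) (ext w) x =
      curvatureField D (ext u) (ext v) (ext w) x +
        curvatureField D (ext u') (ext v) (ext w) x := by
  have e : (fun y ↦ D (ext w) y ((ext u + ext u') y)) =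
      (fun y ↦ D (ext w) y (ext u y)) + fun y ↦ D (ext w) y (ext u' y) := by
    ext y
    simp only [Pi.add_apply, map_add]
  simp only [curvatureField, ext_add]
  rw [e, D.isCovariantDerivativeOnUniv.add (mdiffAt_cov_ext D u w) (mdiffAt_cov_ext D u' w),
    VectorField.mlieBracket_add_left (mdiffAt_ext u) (mdiffAt_ext u')]
  simp only [Pi.add_apply, map_add, add_apply]
  abel

theorem curvatureField_ext_smul_left {x : M} (c : ℝ) (u v w : TangentSpace 𝓘(ℝ, E) x) :
    curvatureField D (ext (c • u)) (ext v) (ext w) x =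
      c • curvatureField D (ext u) (ext v) (ext w) x := by
  have e : (fun y ↦ D (ext w) y ((c • ext u) y)) = c • (fun y ↦ D (ext w) y (ext u y)) := by
    ext y
    simp only [Pi.smul_apply, map_smul]
  simp only [curvatureField, ext_smul]
  rw [e, D.isCovariantDerivativeOnUniv.smul_const c (mdiffAt_cov_ext D u w),
    VectorField.mlieBracket_const_smul_left (mdiffAt_ext u)]
  simp only [Pi.smul_apply, map_smul, smul_apply, smul_sub]

theorem cov_cov_ext_add {x : M} (u v w w' : TangentSpace 𝓘(ℝ, E) x) :
    D (fun y ↦ D (ext (w + w')) y (ext v y)) x u =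
      D (fun y ↦ D (ext w) y (ext v y)) x u + D (fun y ↦ D (ext w') y (ext v y)) x u := by
  have h : D (fun y ↦ D (ext (w + w')) y (ext v y)) x =
      D ((fun y ↦ D (ext w) y (ext v y)) + fun y ↦ D (ext w') y (ext v y)) x := by
    refine D.isCovariantDerivativeOnUniv.congr_of_eventuallyEq (s := Set.univ)
      (mdiffAt_cov_ext D v (w + w'))
      (mdifferentiableAt_add_section (mdiffAt_cov_ext D v w) (mdiffAt_cov_ext D v w'))
      Filter.univ_mem ?_
    filter_upwards [eventually_mdiffAt_ext w, eventually_mdiffAt_ext w'] with y h1 h2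
    rw [ext_add, D.isCovariantDerivativeOnUniv.add h1 h2]
    rfl
  rw [h, D.isCovariantDerivativeOnUniv.add (mdiffAt_cov_ext D v w) (mdiffAt_cov_ext D v w')]
  rfl

theorem cov_cov_ext_smul {x : M} (c : ℝ) (u v w : TangentSpace 𝓘(ℝ, E) x) :
    D (fun y ↦ D (ext (c • w)) y (ext v y)) x u =
      c • D (fun y ↦ D (ext w) y (ext v y)) x u := by
  have h : D (fun y ↦ D (ext (c • w)) y (ext v y)) x =
      D (c • fun y ↦ D (ext w) y (ext v y)) x := by
    refine D.isCovariantDerivativeOnUniv.congr_of_eventuallyEq (s := Set.univ)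
      (mdiffAt_cov_ext D v (c • w))
      (mdifferentiableAt_const.smul_section (mdiffAt_cov_ext D v w))
      Filter.univ_mem ?_
    filter_upwards [eventually_mdiffAt_ext w] with y h1
    rw [ext_smul, D.isCovariantDerivativeOnUniv.smul_const c h1]
    rfl
  rw [h, D.isCovariantDerivativeOnUniv.smul_const c (mdiffAt_cov_ext D v w)]
  rfl

theorem curvatureField_ext_add_section {x : M} (u v w w' : TangentSpace 𝓘(ℝ, E) x) :
    curvatureField D (ext u) (ext v) (ext (w + w')) x =
      curvatureField D (ext u) (ext v) (ext w) x +
        curvatureField D (ext u) (ext v) (ext w') x := by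
  simp only [curvatureField, cov_cov_ext_add]
  rw [ext_add, D.isCovariantDerivativeOnUniv.add (mdiffAt_ext w) (mdiffAt_ext w')]
  simp only [add_apply]
  abel

theorem curvatureField_ext_smul_section {x : M} (c : ℝ) (u v w : TangentSpace 𝓘(ℝ, E) x) :
    curvatureField D (ext u) (ext v) (ext (c • w)) x =
      c • curvatureField D (ext u) (ext v) (ext w) x := by
  simp only [curvatureField, cov_cov_ext_smul]
  rw [ext_smul, D.isCovariantDerivativeOnUniv.smul_const c (mdiffAt_ext w)]
  simp only [smul_apply, smul_sub]

/-- The curvature tensor `R(u, v)w` at `x` of a smooth connection: the value at `x` of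
`∇_X ∇_Y Z - ∇_Y ∇_X Z - ∇_{[X, Y]} Z` for (smooth) local extensions `X`, `Y`, `Z`
of `u`, `v`, `w`. -/
def curvature (x : M) : TangentSpace 𝓘(ℝ, E) x →ₗ[ℝ] TangentSpace 𝓘(ℝ, E) x →ₗ[ℝ]
    TangentSpace 𝓘(ℝ, E) x →ₗ[ℝ] TangentSpace 𝓘(ℝ, E) x :=
  LinearMap.mk₂ ℝ
    (fun u v ↦
      { toFun := fun w ↦ curvatureField D (ext u) (ext v) (ext w) x
        map_add' := curvatureField_ext_add_section D u v
        map_smul' := fun c w ↦ curvatureField_ext_smul_section D c u v w })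
    (fun u u' v ↦ LinearMap.ext fun w ↦ curvatureField_ext_add_left D u u' v w)
    (fun c u v ↦ LinearMap.ext fun w ↦ curvatureField_ext_smul_left D c u v w)
    (fun u v v' ↦ LinearMap.ext fun w ↦ by
      change curvatureField D (ext u) (ext (v + v')) (ext w) x =
        curvatureField D (ext u) (ext v) (ext w) x + curvatureField D (ext u) (ext v') (ext w) x
      rw [curvatureField_swap, curvatureField_ext_add_left, neg_add,
        ← curvatureField_swap, ← curvatureField_swap])
    (fun c u v ↦ LinearMap.ext fun w ↦ by
      change curvatureField D (ext u) (ext (c • v)) (ext w) x =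
        c • curvatureField D (ext u) (ext v) (ext w) x
      rw [curvatureField_swap, curvatureField_ext_smul_left, ← smul_neg, ← curvatureField_swap])
end

end Curvature

/-! ### Almost Hermitian structures and their canonical connections -/

variable {E : Type*} [NormedAddCommGroup E] [NormedSpace ℝ E] [FiniteDimensional ℝ E]
  [CompleteSpace E]
  {M : Type*} [TopologicalSpace M] [T2Space M] [ChartedSpace E M] [IsManifold 𝓘(ℝ, E) ∞ M]

variable (E M) in
/-- An almost Hermitian structure `(J, g)` on a smooth manifold: a smooth Riemannian metric `g` and
a smooth almost complex structure `J` such that `g` is `J`-invariant. -/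
structure AlmostHermitianStructure where
  g : ContMDiffRiemannianMetric 𝓘(ℝ, E) ∞ E (fun x : M ↦ TangentSpace 𝓘(ℝ, E) x)
  J : Π x : M, TangentSpace 𝓘(ℝ, E) x →L[ℝ] TangentSpace 𝓘(ℝ, E) x
  contMDiff_J : ContMDiff 𝓘(ℝ, E) (𝓘(ℝ, E).prod 𝓘(ℝ, E →L[ℝ] E)) ∞
    (fun x : M ↦ TotalSpace.mk' (E →L[ℝ] E)
      (E := fun y : M ↦ TangentSpace 𝓘(ℝ, E) y →L[ℝ] TangentSpace 𝓘(ℝ, E) y) x (J x))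
  J_J : ∀ (x : M) (v : TangentSpace 𝓘(ℝ, E) x), J x (J x v) = -v
  g_J_J : ∀ (x : M) (v w : TangentSpace 𝓘(ℝ, E) x),
    g.inner x (J x v) (J x w) = g.inner x v w

variable (E) in
/-- The complexified tangent space `ℂ ⊗ T_x M`. -/
abbrev CTangent (x : M) : Type _ := ℂ ⊗[ℝ] TangentSpace 𝓘(ℝ, E) x

variable (A : AlmostHermitianStructure E M)

/-- `T'_x M`: the eigenspace of (the complexification of) `J` for the eigenvalue `√-1`. -/
def TOneZero (x : M) : Submodule ℂ (CTangent E x) :=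
  Module.End.eigenspace ((A.J x).toLinearMap.baseChange ℂ) Complex.I

/-- The `ℂ`-bilinear extension of the metric `g` to `ℂ ⊗ T_x M`. -/
def gC (x : M) : LinearMap.BilinForm ℂ (CTangent E x) :=
  LinearMap.BilinForm.baseChange ℂ (A.g.inner x).toBilinForm

/-- The Hermitian metric `g(X, Ȳ)`; its restriction to `T'_x M` is the Hermitian metric induced
by `g`. -/
def herm {x : M} (X Y : CTangent E x) : ℂ := gC A x X (conjC _ Y)

/-- `D` is the canonical connection of the almost Hermitian manifold: `∇J = 0`, `∇g = 0`, and
the `(1,1)`-part of the torsion vanishes, i.e. `T(X, Ȳ) = 0` for all `X`, `Y` of type `(1,0)`. -/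
structure IsCanonicalConnection
    (D : CovariantDerivative 𝓘(ℝ, E) E (TangentSpace 𝓘(ℝ, E) : M → Type _)) : Prop where
  parallel_J : ∀ (x : M) (Y : Π y : M, TangentSpace 𝓘(ℝ, E) y), MDiffAt (T% Y) x →
    ∀ u : TangentSpace 𝓘(ℝ, E) x, D (fun y ↦ A.J y (Y y)) x u = A.J x (D Y x u)
  parallel_g : ∀ (x : M) (Y Z : Π y : M, TangentSpace 𝓘(ℝ, E) y),
    MDiffAt (T% Y) x → MDiffAt (T% Z) x → ∀ u : TangentSpace 𝓘(ℝ, E) x,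
      (mvfderiv 𝓘(ℝ, E) (fun y ↦ A.g.inner y (Y y) (Z y)) x) u =
        A.g.inner x (D Y x u) (Z x) + A.g.inner x (Y x) (D Z x u)
  torsion_one_one : ∀ (x : M), ∀ X ∈ TOneZero A x, ∀ Y ∈ TOneZero A x,
    LinearMap.BilinMap.baseChange ℂ (D.torsion x).toLinearMap₁₂ X (conjC _ Y) = 0

section CurvatureQuantities

variable (D : CovariantDerivative 𝓘(ℝ, E) E (TangentSpace 𝓘(ℝ, E) : M → Type _))
  [D.ContMDiffCovariantDerivative ∞]

/-- `g(R(Z, W̄)X, Ȳ)`, which is `R^j_{i k l̄} X^i Ȳ^j Z^k W̄^l` in a unitary frame. -/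
def curv {x : M} (X Y Z W : CTangent E x) : ℂ :=
  herm A (complexify₃ (curvature D x) Z (conjC _ W) X) Y

/-- Holomorphic bisectional curvature `R^j_{i k l̄} X^i X̄^j Y^k Ȳ^l / (|X|² |Y|²)`. -/
def HB {x : M} (X Y : CTangent E x) : ℂ :=
  curv A D X X Y Y / (herm A X X * herm A Y Y)

/-- Holomorphic sectional curvature `R^j_{i k l̄} X^i X̄^j X^k X̄^l / |X|⁴`. -/
def HS {x : M} (X : CTangent E x) : ℂ :=
  curv A D X X X X / (herm A X X) ^ 2

/-- `HB ≤ B`: the holomorphic bisectional curvature (a real number for a Hermitian connection)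
is at most `B` for all nonzero vectors of type `(1,0)` at all points. -/
def HBLe (B : ℝ) : Prop :=
  ∀ x : M, ∀ X ∈ TOneZero A x, ∀ Y ∈ TOneZero A x, X ≠ 0 → Y ≠ 0 → (HB A D X Y).re ≤ B

/-- `e` is a unitary frame of `T'_x M`, where `dim_ℝ M = 2m`. -/
structure IsUnitaryFrame {m : ℕ} {x : M} (e : Fin m → CTangent E x) : Prop where
  mem : ∀ i, e i ∈ TOneZero A x
  unitary : ∀ i j, herm A (e i) (e j) = if i = j then 1 else 0

/-- First Ricci curvature `Ric'(X, Ȳ) = R^i_{i k l̄} X^k Ȳ^l`, in the unitary frame `e`. -/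
def ricci₁ {m : ℕ} {x : M} (e : Fin m → CTangent E x) (X Y : CTangent E x) : ℂ :=
  ∑ i, curv A D (e i) (e i) X Y

/-- Second Ricci curvature `Ric''(X, Ȳ) = R^l_{k i ī} X^k Ȳ^l`, in the unitary frame `e`. -/
def ricci₂ {m : ℕ} {x : M} (e : Fin m → CTangent E x) (X Y : CTangent E x) : ℂ :=
  ∑ i, curv A D X Y (e i) (e i)

/-- Scalar curvature `R = ∑_{i,j} R^i_{i j j̄}`, in the unitary frame `e`: the trace of
`Ric'` (and of `Ric''`). -/
def scalar {m : ℕ} {x : M} (e : Fin m → CTangent E x) : ℂ :=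
  ∑ i, ∑ j, curv A D (e i) (e i) (e j) (e j)

end CurvatureQuantities

/-- The form `H` is Hermitian and negative semi-definite on `T'_x M`; `≤` is the order of `ℂ`, so
that `H(X, X) ≤ 0` includes that `H(X, X)` is real. -/
def IsNegSemidef {x : M} (H : CTangent E x → CTangent E x → ℂ) : Prop :=
  (∀ X ∈ TOneZero A x, ∀ Y ∈ TOneZero A x, H Y X = conj (H X Y)) ∧ ∀ X ∈ TOneZero A x, H X X ≤ 0

variable {E' : Type*} [NormedAddCommGroup E'] [NormedSpace ℝ E']
  {M' : Type*} [TopologicalSpace M'] [ChartedSpace E' M'] [IsManifold 𝓘(ℝ, E') ∞ M']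

/-- `f` is a pseudoholomorphic isometry: a smooth map with `df ∘ J = J' ∘ df` and `f^* g' = g`. -/
structure IsPseudoholomorphicIsometry (A' : AlmostHermitianStructure E' M') (f : M → M') :
    Prop where
  contMDiff : ContMDiff 𝓘(ℝ, E) 𝓘(ℝ, E') ∞ f
  pseudoholomorphic : ∀ (x : M) (v : TangentSpace 𝓘(ℝ, E) x),
    mfderiv 𝓘(ℝ, E) 𝓘(ℝ, E') f x (A.J x v) = A'.J (f x) (mfderiv 𝓘(ℝ, E) 𝓘(ℝ, E') f x v)
  isometry : ∀ (x : M) (v w : TangentSpace 𝓘(ℝ, E) x),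
    A'.g.inner (f x) (mfderiv 𝓘(ℝ, E) 𝓘(ℝ, E') f x v) (mfderiv 𝓘(ℝ, E) 𝓘(ℝ, E') f x w) =
      A.g.inner x v w

end AlmostHermitian

end

/-!
A pseudoholomorphic isometry decreases holomorphic bisectional curvature, as a complex submanifold
of a Kähler manifold does; the three assertions follow by summing over a unitary frame, or by
putting `Y = X`.

Let `B(u, v) = ∇'_u (df v) - df (∇_u v)` be the second fundamental form of `f`. Since `∇J = 0` and
`∇'J' = 0`, it is complex linear in `v`. The vanishing of the `(1,1)`-parts of the torsions says
that `Q(u, v) = B(u, v) + J' B(Ju, v)` is symmetric; but `Q` is antilinear in `u` and linear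
in `v`, so `Q = 0`, i.e. `B` is complex linear in `u` as well. As both connections are metric,
`g'(B(u, v), df w)` is skew-symmetric in `v` and `w`, and together with complex bilinearity this
forces it to vanish: `∇` is the tangential part of `∇'`. This yields the Gauss equation
`IsLocalIsometry.gauss_equation`, in which no torsion term appears. For the arguments
`(u, Ju, w, Jw)`, the complex bilinearity of `B` turns its correction term into `-2 |B(u, w)|²`
(`IsLocalIsometry.bisectional_le`). For vectors `X = w - √-1 Jw` and `Y = u - √-1 Ju` of type
`(1,0)`, the bisectional curvature is `-g(R(u, Ju)w, Jw) / (|u|² |w|²)`, because the curvature of a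
metric connection is skew-adjoint (`IsCanonicalConnection.curv_oneZero`); hence
`IsPseudoholomorphicIsometry.curv_le`.

Vector fields cannot be pushed forward along `f`, so the Gauss equation is proved in charts
at `x` and `f x`: connections become Christoffel maps `Γ p v u` (the covariant derivative of the
constant field `v` in the direction `u`), and the equation results from differentiating the identity
`g'(B(v, w), df z) = 0`. The dictionary between both settings consists of `coordL_curvature`,
`IsCanonicalConnection.isLocalCanonical` and
`IsPseudoholomorphicIsometry.eventually_isLocalIsometry`.
-/

noncomputable section

set_option linter.unusedSectionVars false
-- nested spaces of continuous linear maps need a deeper instance search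
set_option maxSynthPendingDepth 3

namespace AlmostHermitian

/-! ### Canonical connections in a chart -/

section Calculus

variable {E : Type*} [NormedAddCommGroup E] [NormedSpace ℝ E]
  {E' : Type*} [NormedAddCommGroup E'] [NormedSpace ℝ E']

section

variable {F₁ F₂ F₃ : Type*} [NormedAddCommGroup F₁] [NormedSpace ℝ F₁]
  [NormedAddCommGroup F₂] [NormedSpace ℝ F₂] [NormedAddCommGroup F₃] [NormedSpace ℝ F₃]

theorem fderiv_clm_apply_apply {c : E → F₁ →L[ℝ] F₂} {a : E → F₁} {p : E}
    (hc : DifferentiableAt ℝ c p) (ha : DifferentiableAt ℝ a p) (u : E) :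
    fderiv ℝ (fun q ↦ c q (a q)) p u = fderiv ℝ c p u (a p) + c p (fderiv ℝ a p u) := by
  rw [fderiv_clm_apply hc ha]
  simp [add_comm]

theorem fderiv_clm_apply₂_apply {c : E → F₁ →L[ℝ] F₂ →L[ℝ] F₃} {a : E → F₁} {b : E → F₂} {p : E}
    (hc : DifferentiableAt ℝ c p) (ha : DifferentiableAt ℝ a p) (hb : DifferentiableAt ℝ b p)
    (u : E) :
    fderiv ℝ (fun q ↦ c q (a q) (b q)) p u =
      fderiv ℝ c p u (a p) (b p) + c p (fderiv ℝ a p u) (b p) + c p (a p) (fderiv ℝ b p u) := by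
  rw [fderiv_clm_apply_apply (hc.clm_apply ha) hb, fderiv_clm_apply_apply hc ha]
  simp

theorem fderiv_comp_apply {c : F₁ → F₂} {F : E → F₁} {p : E}
    (hc : DifferentiableAt ℝ c (F p)) (hF : DifferentiableAt ℝ F p) (u : E) :
    fderiv ℝ (fun q ↦ c (F q)) p u = fderiv ℝ c (F p) (fderiv ℝ F p u) := by
  have := fderiv_comp p hc hF
  simp only [Function.comp_def] at this
  rw [this]
  rfl

end

/-- The coordinate expression at `p` of an almost Hermitian structure `(G, J)` on an open subset of
a vector space, together with a canonical connection with Christoffel map `Γ`: here `Γ p v u` is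
the covariant derivative in the direction `u` of the constant vector field `v`. The vanishing of
the `(1,1)`-part of the torsion `T` is expressed in real terms, as `T(u, v) + T(Ju, Jv) = 0`. -/
structure IsLocalCanonical (G : E → E →L[ℝ] E →L[ℝ] ℝ) (J : E → E →L[ℝ] E)
    (Γ : E → E →L[ℝ] E →L[ℝ] E) (p : E) : Prop where
  contDiffAt_G : ContDiffAt ℝ 2 G p
  differentiableAt_J : DifferentiableAt ℝ J p
  symm : ∀ v w, G p v w = G p w v
  nonneg : ∀ v, 0 ≤ G p v v
  J_J : ∀ v, J p (J p v) = -v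
  G_J_J : ∀ v w, G p (J p v) (J p w) = G p v w
  fderiv_G : ∀ u v w, fderiv ℝ G p u v w = G p (Γ p v u) w + G p v (Γ p w u)
  fderiv_J : ∀ u v, fderiv ℝ J p u v + Γ p (J p v) u = J p (Γ p v u)
  torsion : ∀ u v, Γ p v u - Γ p u v + (Γ p (J p v) (J p u) - Γ p (J p u) (J p v)) = 0

/-- The curvature `R(u, v)w` of the connection with Christoffel map `Γ`, for constant vector
fields `u`, `v`, `w`. -/
def localCurv (Γ : E → E →L[ℝ] E →L[ℝ] E) (p u v w : E) : E :=
  fderiv ℝ Γ p u w v + Γ p (Γ p w v) u - (fderiv ℝ Γ p v w u + Γ p (Γ p w u) v)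

namespace IsLocalCanonical

variable {G : E → E →L[ℝ] E →L[ℝ] ℝ} {J : E → E →L[ℝ] E} {Γ : E → E →L[ℝ] E →L[ℝ] E}

/-- The curvature is skew-adjoint: antisymmetrizing the second derivative of `G(w, z)`, which is
symmetric, leaves exactly the curvature terms. -/
theorem localCurv_skew {p : E} (h : ∀ᶠ q in 𝓝 p, IsLocalCanonical G J Γ q)
    (hΓ : DifferentiableAt ℝ Γ p) (u v w z : E) :
    G p (localCurv Γ p u v w) z = -G p (localCurv Γ p u v z) w := by
  have hp := h.self_of_nhds
  have hG : DifferentiableAt ℝ G p := hp.contDiffAt_G.differentiableAt (by simp)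
  have hG' : DifferentiableAt ℝ (fderiv ℝ G) p :=
    (hp.contDiffAt_G.fderiv_right (m := 1) (by norm_num)).differentiableAt (by simp)
  have hsymm : IsSymmSndFDerivAt ℝ G p := hp.contDiffAt_G.isSymmSndFDerivAt (by simp)
  have hΓ2 : ∀ a b : E, DifferentiableAt ℝ (fun q ↦ Γ q a b) p := fun a b ↦
    (hΓ.clm_apply (differentiableAt_const a)).clm_apply (differentiableAt_const b)
  have dΓ : ∀ a b c : E, fderiv ℝ (fun q ↦ Γ q a b) p c = fderiv ℝ Γ p c a b := fun a b c ↦ by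
    simpa using fderiv_clm_apply₂_apply hΓ (differentiableAt_const a) (differentiableAt_const b) c
  have key : ∀ a b : E, fderiv ℝ (fderiv ℝ G) p a b w z =
      G p (Γ p (Γ p w b) a) z + G p (Γ p w b) (Γ p z a) + G p (fderiv ℝ Γ p a w b) z +
      (G p (Γ p w a) (Γ p z b) + G p w (Γ p (Γ p z b) a) + G p w (fderiv ℝ Γ p a z b)) := by
    intro a b
    have e1 : (fun q ↦ fderiv ℝ G q b w z) =ᶠ[𝓝 p]
        fun q ↦ G q (Γ q w b) z + G q w (Γ q z b) := by
      filter_upwards [h] with q hq using hq.fderiv_G b w z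
    have e2 := congrArg (fun L : E →L[ℝ] ℝ ↦ L a) e1.fderiv_eq
    have e3 : fderiv ℝ (fun q ↦ fderiv ℝ G q b w z) p a = fderiv ℝ (fderiv ℝ G) p a b w z := by
      have := fderiv_clm_apply₂_apply (hG'.clm_apply (differentiableAt_const b))
        (differentiableAt_const w) (differentiableAt_const z) a
      have h2 := fderiv_clm_apply_apply hG' (differentiableAt_const b) a
      simp only [fderiv_fun_const, Pi.zero_apply, zero_apply, map_zero, add_zero] at this h2
      rw [this, h2]
    rw [e3, fderiv_fun_add ((hG.clm_apply (hΓ2 w b)).clm_apply (differentiableAt_const z))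
      ((hG.clm_apply (differentiableAt_const w)).clm_apply (hΓ2 z b)), add_apply,
      fderiv_clm_apply₂_apply hG (hΓ2 w b) (differentiableAt_const z),
      fderiv_clm_apply₂_apply hG (differentiableAt_const w) (hΓ2 z b), dΓ, dΓ,
      hp.fderiv_G, hp.fderiv_G] at e2
    simp only [fderiv_fun_const, Pi.zero_apply, zero_apply, map_zero, add_zero] at e2
    rw [e2]
  have k1 := key u v
  have k2 := key v u
  rw [hsymm.eq u v, k2] at k1
  simp only [localCurv, map_sub, map_add, sub_apply, add_apply]
  rw [hp.symm (fderiv ℝ Γ p u z v) w, hp.symm (fderiv ℝ Γ p v z u) w,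
    hp.symm (Γ p (Γ p z v) u) w, hp.symm (Γ p (Γ p z u) v) w]
  linarith

end IsLocalCanonical

/-- The second fundamental form `B(u, v) = ∇'_u (dF v) - dF (∇_u v)` at `p` of a map `F`, in terms
of the Christoffel maps `Γ` of the source and `Γ'` of the target. -/
def secondFF (Γ : E → E →L[ℝ] E →L[ℝ] E) (Γ' : E' → E' →L[ℝ] E' →L[ℝ] E') (F : E → E')
    (p u v : E) : E' :=
  fderiv ℝ (fderiv ℝ F) p u v + Γ' (F p) (fderiv ℝ F p v) (fderiv ℝ F p u) -
    fderiv ℝ F p (Γ p v u)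

/-- Near `p`, the map `F` is a pseudoholomorphic isometry between local almost Hermitian structures
`(G, J)` and `(G', J')`, and `Γ`, `Γ'` are Christoffel maps of canonical connections at `p` and
`F p`. The two conditions on the differential hold in a neighbourhood, since they are
differentiated. -/
structure IsLocalIsometry (G : E → E →L[ℝ] E →L[ℝ] ℝ) (J : E → E →L[ℝ] E)
    (Γ : E → E →L[ℝ] E →L[ℝ] E) (G' : E' → E' →L[ℝ] E' →L[ℝ] ℝ) (J' : E' → E' →L[ℝ] E')
    (Γ' : E' → E' →L[ℝ] E' →L[ℝ] E') (F : E → E') (p : E) : Prop where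
  contDiffAt : ContDiffAt ℝ 3 F p
  source : IsLocalCanonical G J Γ p
  target : IsLocalCanonical G' J' Γ' (F p)
  isometry : ∀ᶠ q in 𝓝 p, ∀ v w, G' (F q) (fderiv ℝ F q v) (fderiv ℝ F q w) = G q v w
  holomorphic : ∀ᶠ q in 𝓝 p, ∀ v, fderiv ℝ F q (J q v) = J' (F q) (fderiv ℝ F q v)

namespace IsLocalIsometry

variable {G : E → E →L[ℝ] E →L[ℝ] ℝ} {J : E → E →L[ℝ] E} {Γ : E → E →L[ℝ] E →L[ℝ] E}
  {G' : E' → E' →L[ℝ] E' →L[ℝ] ℝ} {J' : E' → E' →L[ℝ] E'} {Γ' : E' → E' →L[ℝ] E' →L[ℝ] E'}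
  {F : E → E'} {p : E}

theorem differentiableAt (h : IsLocalIsometry G J Γ G' J' Γ' F p) : DifferentiableAt ℝ F p :=
  h.contDiffAt.differentiableAt (by simp)

theorem differentiableAt_fderiv (h : IsLocalIsometry G J Γ G' J' Γ' F p) :
    DifferentiableAt ℝ (fderiv ℝ F) p :=
  (h.contDiffAt.fderiv_right (m := 1) (by norm_num)).differentiableAt (by simp)

theorem fderiv_fderiv_symm (h : IsLocalIsometry G J Γ G' J' Γ' F p) (u v : E) :
    fderiv ℝ (fderiv ℝ F) p u v = fderiv ℝ (fderiv ℝ F) p v u :=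
  (h.contDiffAt.isSymmSndFDerivAt (by simp; norm_num)).eq u v

theorem differentiableAt_fderiv_apply (h : IsLocalIsometry G J Γ G' J' Γ' F p) (v : E) :
    DifferentiableAt ℝ (fun q ↦ fderiv ℝ F q v) p :=
  h.differentiableAt_fderiv.clm_apply (differentiableAt_const v)

theorem fderiv_fderiv_apply (h : IsLocalIsometry G J Γ G' J' Γ' F p) (u v : E) :
    fderiv ℝ (fun q ↦ fderiv ℝ F q v) p u = fderiv ℝ (fderiv ℝ F) p u v := by
  simpa using fderiv_clm_apply_apply h.differentiableAt_fderiv (differentiableAt_const v) u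

/-- The derivative of `dF ∘ J = J' ∘ dF`, where `J` and `J'` are parallel. -/
theorem secondFF_J_right (h : IsLocalIsometry G J Γ G' J' Γ' F p) (u v : E) :
    secondFF Γ Γ' F p u (J p v) = J' (F p) (secondFF Γ Γ' F p u v) := by
  have hJ := h.source.differentiableAt_J
  have hJ' := h.target.differentiableAt_J
  have e : (fun q ↦ fderiv ℝ F q (J q v)) =ᶠ[𝓝 p] fun q ↦ J' (F q) (fderiv ℝ F q v) := by
    filter_upwards [h.holomorphic] with q hq using hq v
  have e2 := congrArg (fun L : E →L[ℝ] E' ↦ L u) e.fderiv_eq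
  rw [fderiv_clm_apply_apply h.differentiableAt_fderiv (hJ.clm_apply (differentiableAt_const v)),
    fderiv_clm_apply_apply hJ (differentiableAt_const v),
    fderiv_clm_apply_apply (c := fun q ↦ J' (F q)) (hJ'.comp p h.differentiableAt)
      (h.differentiableAt_fderiv_apply v),
    fderiv_comp_apply hJ' h.differentiableAt, h.fderiv_fderiv_apply] at e2
  simp only [fderiv_fun_const, Pi.zero_apply, zero_apply, map_zero, add_zero] at e2
  have h1 := congrArg (fderiv ℝ F p) (h.source.fderiv_J u v)
  have h2 := h.target.fderiv_J (fderiv ℝ F p u) (fderiv ℝ F p v)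
  have hF := h.holomorphic.self_of_nhds
  rw [map_add, hF] at h1
  simp only [secondFF, map_add, map_sub]
  rw [hF v, ← h1, ← h2, ← sub_eq_zero]
  rw [← sub_eq_zero] at e2
  rw [← e2]
  abel

/-- The one place where the torsion enters. -/
theorem secondFF_J_left (h : IsLocalIsometry G J Γ G' J' Γ' F p) (u v : E) :
    secondFF Γ Γ' F p (J p u) v = J' (F p) (secondFF Γ Γ' F p u v) := by
  -- `Q` measures the failure of complex linearity in the first variable; it is symmetric by the
  -- torsion condition, antilinear in the first and linear in the second variable, hence zero.
  set Q : E → E → E' := fun a b ↦ secondFF Γ Γ' F p a b +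
    J' (F p) (secondFF Γ Γ' F p (J p a) b) with hQ
  have hF := h.holomorphic.self_of_nhds
  have hsymm : ∀ a b, Q a b = Q b a := by
    intro a b
    have h1 := congrArg (fderiv ℝ F p) (h.source.torsion a b)
    have h2 := h.target.torsion (fderiv ℝ F p a) (fderiv ℝ F p b)
    simp only [hQ]
    rw [← h.secondFF_J_right, ← h.secondFF_J_right, ← sub_eq_zero]
    simp only [← hF, map_add, map_sub, map_zero] at h1 h2
    simp only [secondFF]
    rw [h.fderiv_fderiv_symm a b, h.fderiv_fderiv_symm (J p a) (J p b)]
    refine Eq.trans ?_ ((congrArg₂ (fun s t ↦ s - t) h2 h1).trans (sub_zero 0))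
    abel
  have hlin : ∀ a b, Q a (J p b) = J' (F p) (Q a b) := fun a b ↦ by
    simp only [hQ, h.secondFF_J_right, map_add]
  have hneg : ∀ a, secondFF Γ Γ' F p (-a) v = -secondFF Γ Γ' F p a v := fun a ↦ by
    simp only [secondFF, map_neg, neg_apply]
    abel
  have hanti : ∀ a, Q (J p a) v = -J' (F p) (Q a v) := fun a ↦ by
    simp only [hQ, map_add, h.target.J_J, h.source.J_J, hneg, map_neg]
    abel
  have h0 : Q u v = 0 := by
    have h1 : J' (F p) (Q u v) = -J' (F p) (Q u v) := by
      rw [← hanti, hsymm (J p u) v, hlin, hsymm v u]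
    have h2 : J' (F p) (Q u v) = 0 := by
      have h3 : (2 : ℝ) • J' (F p) (Q u v) = 0 := by
        rw [two_smul]
        exact add_eq_zero_iff_eq_neg.2 h1
      simpa using h3
    rw [← neg_eq_zero, ← h.target.J_J, h2, map_zero]
  have h1 := congrArg (J' (F p)) h0
  simp only [hQ, map_add, h.target.J_J, map_zero] at h1
  rw [← sub_eq_add_neg, sub_eq_zero] at h1
  exact h1.symm

/-- The second fundamental form of a pseudoholomorphic isometry takes values in the normal space,
that is, the canonical connection of the source is the tangential part of that of the target. -/
theorem inner_secondFF_fderiv (h : IsLocalIsometry G J Γ G' J' Γ' F p) (u v w : E) :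
    G' (F p) (secondFF Γ Γ' F p u v) (fderiv ℝ F p w) = 0 := by
  have hG := h.source.contDiffAt_G.differentiableAt (by simp)
  have hG' := h.target.contDiffAt_G.differentiableAt (by simp)
  set S : E → E → E → ℝ := fun a b c ↦ G' (F p) (secondFF Γ Γ' F p a b) (fderiv ℝ F p c) with hS
  have hF := h.holomorphic.self_of_nhds
  have hiso := h.isometry.self_of_nhds
  -- the derivative of `G'(dF b, dF c) = G(b, c)` for two metric connections
  have hskew : ∀ a b c, S a b c = -S a c b := by
    intro a b c
    have e : (fun q ↦ G' (F q) (fderiv ℝ F q b) (fderiv ℝ F q c)) =ᶠ[𝓝 p] fun q ↦ G q b c := by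
      filter_upwards [h.isometry] with q hq using hq b c
    have e2 := congrArg (fun L : E →L[ℝ] ℝ ↦ L a) e.fderiv_eq
    rw [fderiv_clm_apply₂_apply (c := fun q ↦ G' (F q)) (hG'.comp p h.differentiableAt)
        (h.differentiableAt_fderiv_apply b) (h.differentiableAt_fderiv_apply c),
      fderiv_clm_apply₂_apply hG (differentiableAt_const b) (differentiableAt_const c),
      fderiv_comp_apply hG' h.differentiableAt, h.fderiv_fderiv_apply, h.fderiv_fderiv_apply,
      h.source.fderiv_G, h.target.fderiv_G, ← hiso, ← hiso] at e2
    simp only [fderiv_fun_const, Pi.zero_apply, zero_apply, map_zero, add_zero] at e2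
    simp only [hS, secondFF, map_add, map_sub, add_apply, sub_apply]
    rw [h.target.symm (fderiv ℝ (fderiv ℝ F) p a c), h.target.symm (Γ' (F p) (fderiv ℝ F p c) _),
      h.target.symm (fderiv ℝ F p (Γ p c a))]
    linarith
  have hJ : ∀ a b c, S a (J p b) c = -S a b (J p c) := fun a b c ↦ by
    simp only [hS, h.secondFF_J_right, hF]
    rw [← h.target.G_J_J _ (J' (F p) _), h.target.J_J]
    simp
  have hJl : ∀ a b c, S (J p a) b c = S a (J p b) c := fun a b c ↦ by
    simp only [hS, h.secondFF_J_right, h.secondFF_J_left]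
  -- `J` can be moved from the first to either of the other two variables, where skew-symmetry
  -- produces opposite signs
  have h0 : ∀ a b c, S (J p a) b c = 0 := fun a b c ↦ by
    have h1 : S (J p a) b c = -S (J p a) b c := by
      conv_lhs => rw [hskew, hJl, hJ, neg_neg, hskew]
      rw [hJl]
    linarith
  have h1 := h0 (J p u) v w
  have hneg : S (-u) v w = -S u v w := by
    simp only [hS, secondFF, map_add, map_sub, map_neg, neg_apply, add_apply, sub_apply]
    ring
  rw [h.source.J_J, hneg, neg_eq_zero] at h1
  exact h1

/-- The Gauss equation. It is the difference of the derivatives in the directions `u` and `v` of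
`G'(B(v, w), dF z) = 0` and `G'(B(u, w), dF z) = 0`; the third derivatives of `F` cancel. -/
theorem gauss_equation (h : ∀ᶠ q in 𝓝 p, IsLocalIsometry G J Γ G' J' Γ' F q)
    (hΓ : DifferentiableAt ℝ Γ p) (hΓ' : DifferentiableAt ℝ Γ' (F p)) (u v w z : E) :
    G' (F p) (localCurv Γ' (F p) (fderiv ℝ F p u) (fderiv ℝ F p v) (fderiv ℝ F p w))
        (fderiv ℝ F p z) =
      G p (localCurv Γ p u v w) z -
        G' (F p) (secondFF Γ Γ' F p v w) (secondFF Γ Γ' F p u z) +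
        G' (F p) (secondFF Γ Γ' F p u w) (secondFF Γ Γ' F p v z) := by
  have hp := h.self_of_nhds
  have hG' := hp.target.contDiffAt_G.differentiableAt (by simp)
  have hF3 : DifferentiableAt ℝ (fderiv ℝ (fderiv ℝ F)) p :=
    ((hp.contDiffAt.fderiv_right (m := 2) (by norm_num)).fderiv_right (m := 1)
      (by norm_num)).differentiableAt (by simp)
  have hsymm3 : ∀ a b c, fderiv ℝ (fderiv ℝ (fderiv ℝ F)) p a b c =
      fderiv ℝ (fderiv ℝ (fderiv ℝ F)) p b a c := fun a b c ↦ by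
    rw [((hp.contDiffAt.fderiv_right (m := 2) (by norm_num)).isSymmSndFDerivAt (by simp)).eq a b]
  have hΓF : DifferentiableAt ℝ (fun q ↦ Γ' (F q)) p := hΓ'.comp p hp.differentiableAt
  have hB1 : ∀ a b, DifferentiableAt ℝ (fun q ↦ fderiv ℝ (fderiv ℝ F) q a b) p := fun a b ↦
    (hF3.clm_apply (differentiableAt_const a)).clm_apply (differentiableAt_const b)
  have hB2 : ∀ a b, DifferentiableAt ℝ
      (fun q ↦ Γ' (F q) (fderiv ℝ F q b) (fderiv ℝ F q a)) p := fun a b ↦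
    (hΓF.clm_apply (hp.differentiableAt_fderiv_apply b)).clm_apply
      (hp.differentiableAt_fderiv_apply a)
  have hB3' : ∀ a b, DifferentiableAt ℝ (fun q ↦ Γ q b a) p := fun a b ↦
    (hΓ.clm_apply (differentiableAt_const b)).clm_apply (differentiableAt_const a)
  have hB3 : ∀ a b, DifferentiableAt ℝ (fun q ↦ fderiv ℝ F q (Γ q b a)) p := fun a b ↦
    hp.differentiableAt_fderiv.clm_apply (hB3' a b)
  have hB : ∀ a b, DifferentiableAt ℝ (fun q ↦ secondFF Γ Γ' F q a b) p := fun a b ↦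
    ((hB1 a b).add (hB2 a b)).sub (hB3 a b)
  have dB : ∀ a b c, fderiv ℝ (fun q ↦ secondFF Γ Γ' F q b c) p a =
      fderiv ℝ (fderiv ℝ (fderiv ℝ F)) p a b c +
      (fderiv ℝ Γ' (F p) (fderiv ℝ F p a) (fderiv ℝ F p c) (fderiv ℝ F p b) +
        Γ' (F p) (fderiv ℝ (fderiv ℝ F) p a c) (fderiv ℝ F p b) +
        Γ' (F p) (fderiv ℝ F p c) (fderiv ℝ (fderiv ℝ F) p a b)) -
      (fderiv ℝ (fderiv ℝ F) p a (Γ p c b) + fderiv ℝ F p (fderiv ℝ Γ p a c b)) := by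
    intro a b c
    simp only [secondFF]
    rw [fderiv_fun_sub ((hB1 b c).fun_add (hB2 b c)) (hB3 b c), fderiv_fun_add (hB1 b c) (hB2 b c),
      sub_apply, add_apply,
      fderiv_clm_apply₂_apply hF3 (differentiableAt_const b) (differentiableAt_const c),
      fderiv_clm_apply₂_apply hΓF (hp.differentiableAt_fderiv_apply c)
        (hp.differentiableAt_fderiv_apply b),
      fderiv_clm_apply_apply hp.differentiableAt_fderiv (hB3' b c),
      fderiv_clm_apply₂_apply hΓ (differentiableAt_const c) (differentiableAt_const b),
      fderiv_comp_apply hΓ' hp.differentiableAt, hp.fderiv_fderiv_apply, hp.fderiv_fderiv_apply]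
    simp only [fderiv_fun_const, Pi.zero_apply, zero_apply, map_zero, add_zero]
  -- the derivative of the identity expressing that the second fundamental form is normal
  have key : ∀ a b : E,
      G' (F p) (fderiv ℝ (fun q ↦ secondFF Γ Γ' F q b w) p a +
        Γ' (F p) (secondFF Γ Γ' F p b w) (fderiv ℝ F p a)) (fderiv ℝ F p z) +
      G' (F p) (secondFF Γ Γ' F p b w) (secondFF Γ Γ' F p a z) = 0 := by
    intro a b
    have e : (fun q ↦ G' (F q) (secondFF Γ Γ' F q b w) (fderiv ℝ F q z)) =ᶠ[𝓝 p] fun q ↦ 0 := by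
      filter_upwards [h] with q hq using hq.inner_secondFF_fderiv b w z
    have e2 := congrArg (fun L : E →L[ℝ] ℝ ↦ L a) e.fderiv_eq
    rw [fderiv_clm_apply₂_apply (c := fun q ↦ G' (F q)) (hG'.comp p hp.differentiableAt)
        (hB b w) (hp.differentiableAt_fderiv_apply z),
      fderiv_comp_apply hG' hp.differentiableAt, hp.fderiv_fderiv_apply,
      hp.target.fderiv_G] at e2
    have h3 := hp.inner_secondFF_fderiv b w (Γ p z a)
    have h4 : fderiv ℝ (fderiv ℝ F) p a z =
        secondFF Γ Γ' F p a z - Γ' (F p) (fderiv ℝ F p z) (fderiv ℝ F p a) +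
        fderiv ℝ F p (Γ p z a) := by
      simp only [secondFF]; abel
    rw [h4] at e2
    simp only [map_add, map_sub, add_apply, fderiv_fun_const, Pi.zero_apply, zero_apply] at e2 ⊢
    linarith
  have k1 := key u v
  have k2 := key v u
  -- the Codazzi equation for the full, not only the normal, component
  have hvec : (fderiv ℝ (fun q ↦ secondFF Γ Γ' F q v w) p u +
        Γ' (F p) (secondFF Γ Γ' F p v w) (fderiv ℝ F p u)) -
      (fderiv ℝ (fun q ↦ secondFF Γ Γ' F q u w) p v +
        Γ' (F p) (secondFF Γ Γ' F p u w) (fderiv ℝ F p v)) =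
      localCurv Γ' (F p) (fderiv ℝ F p u) (fderiv ℝ F p v) (fderiv ℝ F p w) -
        fderiv ℝ F p (localCurv Γ p u v w) - secondFF Γ Γ' F p u (Γ p w v) +
        secondFF Γ Γ' F p v (Γ p w u) := by
    rw [dB, dB, hsymm3 u v w, hp.fderiv_fderiv_symm u v]
    simp only [secondFF, localCurv, map_add, map_sub, add_apply, sub_apply]
    abel
  have k3 := congrArg (fun a ↦ G' (F p) a (fderiv ℝ F p z)) hvec
  simp only [map_add, map_sub, add_apply, sub_apply, hp.inner_secondFF_fderiv,
    hp.isometry.self_of_nhds] at k1 k2 k3 ⊢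
  linarith

/-- The curvature-decreasing property, for the real expression of the holomorphic bisectional
curvature: the two correction terms in the Gauss equation add up to `-2 |B(u, w)|²`. -/
theorem bisectional_le (h : ∀ᶠ q in 𝓝 p, IsLocalIsometry G J Γ G' J' Γ' F q)
    (hΓ : DifferentiableAt ℝ Γ p) (hΓ' : DifferentiableAt ℝ Γ' (F p)) (u w : E) :
    G' (F p) (localCurv Γ' (F p) (fderiv ℝ F p u) (fderiv ℝ F p (J p u)) (fderiv ℝ F p w))
        (fderiv ℝ F p (J p w)) ≤
      G p (localCurv Γ p u (J p u) w) (J p w) := by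
  have hp := h.self_of_nhds
  rw [gauss_equation h hΓ hΓ']
  simp only [hp.secondFF_J_left, hp.secondFF_J_right, hp.target.G_J_J, hp.target.J_J, map_neg]
  have := hp.target.nonneg (secondFF Γ Γ' F p u w)
  linarith

end IsLocalIsometry

end Calculus

/-! ### Coordinate expressions of functions, vector fields and connections -/

section Charts

variable {E : Type*} [NormedAddCommGroup E] [NormedSpace ℝ E] [FiniteDimensional ℝ E]
  [CompleteSpace E]
  {M : Type*} [TopologicalSpace M] [T2Space M] [ChartedSpace E M] [IsManifold 𝓘(ℝ, E) ∞ M]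

/-- The coordinates of a tangent vector at `y` in the preferred chart at `x`. -/
def coordL (x y : M) : TangentSpace 𝓘(ℝ, E) y →L[ℝ] E :=
  (trivializationAt E (TangentSpace 𝓘(ℝ, E)) x).continuousLinearMapAt ℝ y

/-- The tangent vector at `y` with given coordinates in the preferred chart at `x`; as a function
of `y`, this is a coordinate vector field. -/
def frameL (x y : M) : E →L[ℝ] TangentSpace 𝓘(ℝ, E) y :=
  (trivializationAt E (TangentSpace 𝓘(ℝ, E)) x).symmL ℝ y

variable {x y : M}

theorem mem_baseSet_of_mem_source (hy : y ∈ (chartAt E x).source) :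
    y ∈ (trivializationAt E (TangentSpace 𝓘(ℝ, E)) x).baseSet := by
  simpa using hy

theorem coordL_frameL (hy : y ∈ (chartAt E x).source) (v : E) :
    coordL x y (frameL x y v) = v :=
  Trivialization.continuousLinearMapAt_symmL _ (mem_baseSet_of_mem_source hy) v

theorem frameL_coordL (hy : y ∈ (chartAt E x).source) (v : TangentSpace 𝓘(ℝ, E) y) :
    frameL x y (coordL x y v) = v :=
  Trivialization.symmL_continuousLinearMapAt _ (mem_baseSet_of_mem_source hy) v

theorem coordL_eq_mfderiv (hy : y ∈ (chartAt E x).source) :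
    coordL x y = mfderiv 𝓘(ℝ, E) 𝓘(ℝ, E) (extChartAt 𝓘(ℝ, E) x) y :=
  TangentBundle.continuousLinearMapAt_trivializationAt hy

theorem contMDiffAt_frameL (hy : y ∈ (chartAt E x).source) (v : E) :
    CMDiffAt ∞ (T% (fun z : M ↦ frameL x z v)) y := by
  have h := mem_baseSet_of_mem_source hy
  rw [(trivializationAt E (TangentSpace 𝓘(ℝ, E)) x).contMDiffAt_section_iff h]
  refine (contMDiffAt_const (c := v)).congr_of_eventuallyEq ?_
  filter_upwards [(trivializationAt E (TangentSpace 𝓘(ℝ, E)) x).open_baseSet.mem_nhds h] with z hz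
  rw [← Trivialization.continuousLinearMapAt_apply_of_mem (R := ℝ) _ hz]
  exact Trivialization.continuousLinearMapAt_symmL _ hz v

theorem mdiffAt_frameL (hy : y ∈ (chartAt E x).source) (v : E) :
    MDiffAt (T% (fun z : M ↦ frameL x z v)) y :=
  (contMDiffAt_frameL hy v).mdifferentiableAt (by simp)

theorem mdiffAt_coordL (hy : y ∈ (chartAt E x).source) {Y : Π z : M, TangentSpace 𝓘(ℝ, E) z}
    (hY : MDiffAt (T% Y) y) : MDifferentiableAt 𝓘(ℝ, E) 𝓘(ℝ, E) (fun z ↦ coordL x z (Y z)) y := by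
  have h := mem_baseSet_of_mem_source hy
  rw [(trivializationAt E (TangentSpace 𝓘(ℝ, E)) x).mdifferentiableAt_section_iff 𝓘(ℝ, E) Y h]
    at hY
  refine hY.congr_of_eventuallyEq ?_
  filter_upwards [(trivializationAt E (TangentSpace 𝓘(ℝ, E)) x).open_baseSet.mem_nhds h] with z hz
  exact Trivialization.continuousLinearMapAt_apply_of_mem (R := ℝ) _ hz _

theorem ext_eq_frameL (v : TangentSpace 𝓘(ℝ, E) x) :
    ext v = fun y ↦ frameL x y (coordL x x v) := rfl

/-- The constant vector field on a vector space with value `v`. -/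
def constField (v : E) (q : E) : TangentSpace 𝓘(ℝ, E) q := v

theorem mdiffAt_constField (v q : E) : MDiffAt (T% (constField v)) q :=
  (mdifferentiableAt_section 𝓘(ℝ, E) (E := TangentSpace 𝓘(ℝ, E)) (constField v)).2
    (by simpa [constField] using mdifferentiableAt_const)

theorem mlieBracket_constField (u v q : E) :
    VectorField.mlieBracket 𝓘(ℝ, E) (constField u) (constField v) q = 0 := by
  rw [← VectorField.mlieBracketWithin_univ, VectorField.mlieBracketWithin_eq_lieBracketWithin]
  change fderivWithin ℝ (fun _ : E ↦ v) Set.univ q u -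
    fderivWithin ℝ (fun _ : E ↦ u) Set.univ q v = 0
  simp

/-- Coordinate vector fields commute. -/
theorem mlieBracket_frameL (hy : y ∈ (chartAt E x).source) (u v : E) :
    VectorField.mlieBracket 𝓘(ℝ, E) (fun z : M ↦ frameL x z u) (fun z ↦ frameL x z v) y = 0 := by
  have hframe : ∀ w : E, (fun z : M ↦ frameL x z w) =ᶠ[𝓝 y]
      VectorField.mpullback 𝓘(ℝ, E) 𝓘(ℝ, E) (extChartAt 𝓘(ℝ, E) x) (constField w) := by
    intro w
    filter_upwards [(chartAt E x).open_source.mem_nhds hy] with z hz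
    have hinv : (coordL x z).inverse = frameL x z :=
      ContinuousLinearMap.inverse_eq (ContinuousLinearMap.ext (coordL_frameL hz))
        (ContinuousLinearMap.ext (frameL_coordL hz))
    have h : (mfderiv 𝓘(ℝ, E) 𝓘(ℝ, E) (extChartAt 𝓘(ℝ, E) x) z).inverse =
        frameL (E := E) x z := by
      rw [← coordL_eq_mfderiv hz]
      exact hinv
    exact (congrArg (fun L : E →L[ℝ] TangentSpace 𝓘(ℝ, E) z ↦ L w) h).symm
  have h2 : minSmoothness ℝ 2 ≤ ∞ := by
    rw [minSmoothness_of_isRCLikeNormedField]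
    exact (WithTop.coe_le_coe.2 le_top : ((2 : ℕ∞) : ℕ∞ω) ≤ ∞)
  have : IsManifold 𝓘(ℝ, E) (minSmoothness ℝ 2) M :=
    IsManifold.of_le (n := ∞) h2
  rw [(hframe u).mlieBracket_vectorField_eq (hframe v),
    ← VectorField.mpullback_mlieBracket (n := ∞) (mdiffAt_constField _ _) (mdiffAt_constField _ _)
      (contMDiffAt_extChartAt' hy) h2,
    VectorField.mpullback_apply, mlieBracket_constField, map_zero]

theorem symm_mem_source {q : E} (hq : q ∈ (extChartAt 𝓘(ℝ, E) x).target) :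
    (extChartAt 𝓘(ℝ, E) x).symm q ∈ (chartAt E x).source := by
  simpa using (extChartAt 𝓘(ℝ, E) x).map_target hq

theorem contMDiffAt_extChartAt_symm {q : E} (hq : q ∈ (extChartAt 𝓘(ℝ, E) x).target) :
    ContMDiffAt 𝓘(ℝ, E) 𝓘(ℝ, E) ∞ (extChartAt 𝓘(ℝ, E) x).symm q :=
  (contMDiffOn_extChartAt_symm x).contMDiffAt ((isOpen_extChartAt_target x).mem_nhds hq)

theorem mfderiv_extChartAt_symm_eq_frameL {q : E} (hq : q ∈ (extChartAt 𝓘(ℝ, E) x).target) :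
    mfderiv 𝓘(ℝ, E) 𝓘(ℝ, E) (extChartAt 𝓘(ℝ, E) x).symm q =
      frameL (E := E) x ((extChartAt 𝓘(ℝ, E) x).symm q) := by
  have h := TangentBundle.symmL_trivializationAt (I := 𝓘(ℝ, E)) (symm_mem_source hq)
  rw [(extChartAt 𝓘(ℝ, E) x).right_inv hq] at h
  rw [frameL, h]
  simp
  rfl

variable {V : Type*} [NormedAddCommGroup V] [NormedSpace ℝ V]

theorem differentiableAt_comp_symm {q : E} (hq : q ∈ (extChartAt 𝓘(ℝ, E) x).target) {h : M → V}
    (hh : MDifferentiableAt 𝓘(ℝ, E) 𝓘(ℝ, V) h ((extChartAt 𝓘(ℝ, E) x).symm q)) :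
    DifferentiableAt ℝ (fun p ↦ h ((extChartAt 𝓘(ℝ, E) x).symm p)) q :=
  mdifferentiableAt_iff_differentiableAt.1
    (hh.comp q ((contMDiffAt_extChartAt_symm hq).mdifferentiableAt (by simp)))

theorem contDiffAt_comp_symm {q : E} (hq : q ∈ (extChartAt 𝓘(ℝ, E) x).target) {h : M → V}
    (hh : ContMDiffAt 𝓘(ℝ, E) 𝓘(ℝ, V) ∞ h ((extChartAt 𝓘(ℝ, E) x).symm q)) :
    ContDiffAt ℝ ∞ (fun p ↦ h ((extChartAt 𝓘(ℝ, E) x).symm p)) q :=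
  contMDiffAt_iff_contDiffAt.1 (hh.comp q (contMDiffAt_extChartAt_symm hq))

theorem fderiv_comp_symm {q : E} (hq : q ∈ (extChartAt 𝓘(ℝ, E) x).target) {h : M → V}
    (hh : MDifferentiableAt 𝓘(ℝ, E) 𝓘(ℝ, V) h ((extChartAt 𝓘(ℝ, E) x).symm q)) (u : E) :
    fderiv ℝ (fun p ↦ h ((extChartAt 𝓘(ℝ, E) x).symm p)) q u =
      mvfderiv 𝓘(ℝ, E) h ((extChartAt 𝓘(ℝ, E) x).symm q)
        (frameL x ((extChartAt 𝓘(ℝ, E) x).symm q) u) := by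
  have h1 := mfderiv_comp q hh ((contMDiffAt_extChartAt_symm hq).mdifferentiableAt (by simp))
  rw [mfderiv_extChartAt_symm_eq_frameL hq, mfderiv_eq_fderiv] at h1
  exact congrArg (fun L : E →L[ℝ] V ↦ L u) h1

theorem differentiableAt_clm_of_apply {W : Type*} [NormedAddCommGroup W] [NormedSpace ℝ W]
    {c : E → E →L[ℝ] W} {q : E} (h : ∀ v, DifferentiableAt ℝ (fun p ↦ c p v) q) :
    DifferentiableAt ℝ c q := by
  let b := Module.finBasis ℝ E
  have e : c = fun p ↦ ∑ k,
      (LinearMap.toContinuousLinearMap (b.coord k)).smulRight (c p (b k)) := by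
    ext p v
    conv_lhs => rw [← b.sum_repr v, map_sum]
    simp [-Module.Basis.sum_repr]
  rw [e]
  refine DifferentiableAt.fun_sum fun k _ ↦ ?_
  exact ((ContinuousLinearMap.smulRightL ℝ E W
    (LinearMap.toContinuousLinearMap (b.coord k))).differentiableAt).comp q (h (b k))

theorem contDiffAt_clm_of_apply {W : Type*} [NormedAddCommGroup W] [NormedSpace ℝ W]
    {c : E → E →L[ℝ] W} {q : E} {n : ℕ∞ω} (h : ∀ v, ContDiffAt ℝ n (fun p ↦ c p v) q) :
    ContDiffAt ℝ n c q := by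
  let b := Module.finBasis ℝ E
  have e : c = fun p ↦ ∑ k,
      (LinearMap.toContinuousLinearMap (b.coord k)).smulRight (c p (b k)) := by
    ext p v
    conv_lhs => rw [← b.sum_repr v, map_sum]
    simp [-Module.Basis.sum_repr]
  rw [e]
  refine ContDiffAt.sum fun k _ ↦ ?_
  exact ((ContinuousLinearMap.smulRightL ℝ E W
    (LinearMap.toContinuousLinearMap (b.coord k))).contDiff.contDiffAt).comp q (h (b k))

end Charts

section Christoffel

variable {E : Type*} [NormedAddCommGroup E] [NormedSpace ℝ E] [FiniteDimensional ℝ E]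
  [CompleteSpace E]
  {M : Type*} [TopologicalSpace M] [T2Space M] [ChartedSpace E M] [IsManifold 𝓘(ℝ, E) ∞ M]
  (D : CovariantDerivative 𝓘(ℝ, E) E (TangentSpace 𝓘(ℝ, E) : M → Type _)) {x : M} {q : E}

theorem cov_sum_smul {ι : Type*} (s : Finset ι) {c : ι → M → ℝ}
    {Z : ι → Π z : M, TangentSpace 𝓘(ℝ, E) z} {y : M}
    (hc : ∀ k, MDifferentiableAt 𝓘(ℝ, E) 𝓘(ℝ, ℝ) (c k) y) (hZ : ∀ k, MDiffAt (T% (Z k)) y) :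
    MDiffAt (T% (∑ k ∈ s, c k • Z k)) y ∧
      D (∑ k ∈ s, c k • Z k) y =
        ∑ k ∈ s, (c k y • D (Z k) y + (mvfderiv 𝓘(ℝ, E) (c k) y).smulRight (Z k y)) := by
  classical
  induction s using Finset.induction_on with
  | empty =>
    simp only [Finset.sum_empty]
    exact ⟨mdifferentiableAt_zeroSection ℝ (TangentSpace 𝓘(ℝ, E) : M → Type _), by simp⟩
  | insert k s hk ih =>
    have h1 : MDiffAt (T% (c k • Z k)) y := (hc k).smul_section (hZ k)
    simp only [Finset.sum_insert hk]
    refine ⟨mdifferentiableAt_add_section h1 ih.1, ?_⟩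
    rw [D.isCovariantDerivativeOnUniv.add h1 ih.1, ih.2,
      D.isCovariantDerivativeOnUniv.leibniz (hZ k) (hc k)]

/-- The Christoffel map of a connection in the preferred chart at `x`, at the point with
coordinates `q`: `christoffel D x q v u` is the covariant derivative in the direction `u` of the
coordinate vector field `v`. The definition through a basis makes it linear in `v` also
at points outside of the chart. -/
def christoffel (x : M) (q : E) : E →L[ℝ] E →L[ℝ] E :=
  ∑ k, (LinearMap.toContinuousLinearMap ((Module.finBasis ℝ E).coord k)).smulRight
    (coordL x ((extChartAt 𝓘(ℝ, E) x).symm q) ∘L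
      D (fun z ↦ frameL x z (Module.finBasis ℝ E k)) ((extChartAt 𝓘(ℝ, E) x).symm q) ∘L
        frameL x ((extChartAt 𝓘(ℝ, E) x).symm q))

/-- The coordinate expression of a covariant derivative. -/
theorem coordL_cov (hq : q ∈ (extChartAt 𝓘(ℝ, E) x).target)
    {Y : Π z : M, TangentSpace 𝓘(ℝ, E) z}
    (hY : MDiffAt (T% Y) ((extChartAt 𝓘(ℝ, E) x).symm q)) (u : E) :
    coordL x ((extChartAt 𝓘(ℝ, E) x).symm q) (D Y ((extChartAt 𝓘(ℝ, E) x).symm q)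
        (frameL x ((extChartAt 𝓘(ℝ, E) x).symm q) u)) =
      fderiv ℝ (fun p ↦ coordL x ((extChartAt 𝓘(ℝ, E) x).symm p)
        (Y ((extChartAt 𝓘(ℝ, E) x).symm p))) q u +
      christoffel D x q (coordL x ((extChartAt 𝓘(ℝ, E) x).symm q)
        (Y ((extChartAt 𝓘(ℝ, E) x).symm q))) u := by
  set φ := extChartAt 𝓘(ℝ, E) x with hφ
  set b := Module.finBasis ℝ E with hb
  have hy := symm_mem_source hq
  rw [← hφ] at hy
  set c : Fin (Module.finrank ℝ E) → M → ℝ := fun k z ↦ b.coord k (coordL x z (Y z)) with hc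
  have hYc := mdiffAt_coordL hy hY
  have hcm : ∀ k, MDifferentiableAt 𝓘(ℝ, E) 𝓘(ℝ, ℝ) (c k) (φ.symm q) := fun k ↦
    ((LinearMap.toContinuousLinearMap (b.coord k)).differentiableAt.mdifferentiableAt).comp
      (φ.symm q) hYc
  obtain ⟨h1, h2⟩ := cov_sum_smul D Finset.univ hcm (fun k ↦ mdiffAt_frameL hy (b k))
  have e : D Y (φ.symm q) = D (∑ k, c k • fun z ↦ frameL x z (b k)) (φ.symm q) := by
    refine D.isCovariantDerivativeOnUniv.congr_of_eventuallyEq (s := Set.univ) hY h1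
      Filter.univ_mem ?_
    filter_upwards [(chartAt E x).open_source.mem_nhds hy] with z hz
    rw [Finset.sum_apply]
    simp only [Pi.smul_apply', ← map_smul, ← map_sum, hc, Module.Basis.coord_apply]
    rw [b.sum_repr, frameL_coordL hz]
  have hd : ∀ k, mvfderiv 𝓘(ℝ, E) (c k) (φ.symm q) (frameL x (φ.symm q) u) =
      b.coord k (fderiv ℝ (fun p ↦ coordL x (φ.symm p) (Y (φ.symm p))) q u) := fun k ↦ by
    rw [← fderiv_comp_symm hq (hcm k)]
    exact congrArg (fun L : E →L[ℝ] ℝ ↦ L u)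
      (((LinearMap.toContinuousLinearMap (b.coord k)).hasFDerivAt.comp q
        (differentiableAt_comp_symm hq hYc).hasFDerivAt).fderiv)
  rw [e, h2]
  simp only [sum_apply, add_apply, smul_apply, map_sum, map_add, map_smul,
    ContinuousLinearMap.smulRight_apply, hd, coordL_frameL hy, Finset.sum_add_distrib]
  rw [add_comm]
  congr 1
  · simp only [Module.Basis.coord_apply, b.sum_repr]
  · simp only [christoffel, sum_apply, ContinuousLinearMap.smulRight_apply, smul_apply]
    rfl

theorem christoffel_apply (hq : q ∈ (extChartAt 𝓘(ℝ, E) x).target) (u v : E) :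
    christoffel D x q v u = coordL x ((extChartAt 𝓘(ℝ, E) x).symm q)
      (D (fun z ↦ frameL x z v) ((extChartAt 𝓘(ℝ, E) x).symm q)
        (frameL x ((extChartAt 𝓘(ℝ, E) x).symm q) u)) := by
  have e : (fun p ↦ coordL x ((extChartAt 𝓘(ℝ, E) x).symm p)
      (frameL x ((extChartAt 𝓘(ℝ, E) x).symm p) v)) =ᶠ[𝓝 q] fun _ ↦ v := by
    filter_upwards [(isOpen_extChartAt_target x).mem_nhds hq] with p hp
    exact coordL_frameL (symm_mem_source hp) v
  rw [coordL_cov D hq (mdiffAt_frameL (symm_mem_source hq) v), e.fderiv_eq,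
    coordL_frameL (symm_mem_source hq)]
  simp

variable [D.ContMDiffCovariantDerivative ∞]

theorem mdiffAt_cov_frameL (x : M) (u v : E) :
    MDiffAt (T% fun y ↦ D (fun z ↦ frameL x z v) y (frameL x y u)) x := by
  have h := mdiffAt_cov_ext D (frameL x x u) (frameL x x v)
  simp only [ext_eq_frameL, coordL_frameL (mem_chart_source E x)] at h
  exact h

theorem differentiableAt_christoffel (x : M) :
    DifferentiableAt ℝ (christoffel D x) (extChartAt 𝓘(ℝ, E) x x) := by
  have hq := mem_extChartAt_target (I := 𝓘(ℝ, E)) x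
  refine differentiableAt_clm_of_apply fun v ↦ differentiableAt_clm_of_apply fun u ↦ ?_
  have h : MDifferentiableAt 𝓘(ℝ, E) 𝓘(ℝ, E)
      (fun y ↦ coordL x y (D (fun z ↦ frameL x z v) y (frameL x y u)))
      ((extChartAt 𝓘(ℝ, E) x).symm (extChartAt 𝓘(ℝ, E) x x)) := by
    rw [extChartAt_to_inv]
    exact mdiffAt_coordL (mem_chart_source E x) (mdiffAt_cov_frameL D x u v)
  refine (differentiableAt_comp_symm hq h).congr_of_eventuallyEq ?_
  filter_upwards [extChartAt_target_mem_nhds x] with p hp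
  exact christoffel_apply D hp u v

/-- The second covariant derivative of a coordinate vector field in coordinates. -/
theorem coordL_cov_cov_frameL (x : M) (u v w : E) :
    coordL x x (D (fun y ↦ D (fun z ↦ frameL x z w) y (frameL x y v)) x (frameL x x u)) =
      fderiv ℝ (christoffel D x) (extChartAt 𝓘(ℝ, E) x x) u w v +
        christoffel D x (extChartAt 𝓘(ℝ, E) x x)
          (christoffel D x (extChartAt 𝓘(ℝ, E) x x) w v) u := by
  have hq := mem_extChartAt_target (I := 𝓘(ℝ, E)) x
  have key := coordL_cov D hq (Y := fun y ↦ D (fun z ↦ frameL x z w) y (frameL x y v))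
    (by rw [extChartAt_to_inv]; exact mdiffAt_cov_frameL D x v w) u
  have e : (fun p ↦ coordL x ((extChartAt 𝓘(ℝ, E) x).symm p)
      (D (fun z ↦ frameL x z w) ((extChartAt 𝓘(ℝ, E) x).symm p)
        (frameL x ((extChartAt 𝓘(ℝ, E) x).symm p) v))) =ᶠ[𝓝 (extChartAt 𝓘(ℝ, E) x x)]
      fun p ↦ christoffel D x p w v := by
    filter_upwards [extChartAt_target_mem_nhds x] with p hp
    exact (christoffel_apply D hp v w).symm
  rw [e.fderiv_eq, ← christoffel_apply D hq, fderiv_clm_apply₂_apply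
    (differentiableAt_christoffel D x) (differentiableAt_const w) (differentiableAt_const v)] at key
  rw [extChartAt_to_inv] at key
  simpa using key

/-- The curvature tensor in coordinates. -/
theorem coordL_curvature (x : M) (u v w : TangentSpace 𝓘(ℝ, E) x) :
    coordL x x (curvature D x u v w) =
      localCurv (christoffel D x) (extChartAt 𝓘(ℝ, E) x x) (coordL x x u) (coordL x x v)
        (coordL x x w) := by
  have h : curvature D x u v w = curvatureField D (ext u) (ext v) (ext w) x := rfl
  have h0 : VectorField.mlieBracket 𝓘(ℝ, E) (ext u) (ext v) x = 0 :=
    mlieBracket_frameL (mem_chart_source E x) _ _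
  rw [h, curvatureField, h0, map_zero, sub_zero, map_sub]
  simp only [ext_eq_frameL]
  rw [coordL_cov_cov_frameL, coordL_cov_cov_frameL, localCurv]

end Christoffel

/-! ### Real vectors and vectors of type `(1,0)` -/

section Complexified

/-- The real part of an element of the complexification `ℂ ⊗ V`. -/
def reC (V : Type*) [AddCommGroup V] [Module ℝ V] : (ℂ ⊗[ℝ] V) →ₗ[ℝ] V :=
  (TensorProduct.lid ℝ V).toLinearMap ∘ₗ Complex.reLm.rTensor V

theorem reC_tmul {V : Type*} [AddCommGroup V] [Module ℝ V] (z : ℂ) (v : V) :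
    reC V (z ⊗ₜ v) = z.re • v := by
  simp [reC]

theorem conjC_tmul {V : Type*} [AddCommGroup V] [Module ℝ V] (z : ℂ) (v : V) :
    conjC V (z ⊗ₜ v) = conj z ⊗ₜ v := by
  simp [conjC]

theorem exists_eq_add_I_tmul {V : Type*} [AddCommGroup V] [Module ℝ V] (X : ℂ ⊗[ℝ] V) :
    ∃ a b : V, X = (1 : ℂ) ⊗ₜ[ℝ] a + Complex.I ⊗ₜ[ℝ] b := by
  induction X using TensorProduct.induction_on with
  | zero => exact ⟨0, 0, by simp⟩
  | tmul z v =>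
    refine ⟨z.re • v, z.im • v, ?_⟩
    rw [← TensorProduct.smul_tmul, ← TensorProduct.smul_tmul, ← TensorProduct.add_tmul]
    congr 1
    apply Complex.ext <;> simp
  | add X Y hX hY =>
    obtain ⟨a, b, rfl⟩ := hX
    obtain ⟨c, d, rfl⟩ := hY
    refine ⟨a + c, b + d, ?_⟩
    simp only [TensorProduct.tmul_add]
    abel

variable {E : Type*} [NormedAddCommGroup E] [NormedSpace ℝ E] [FiniteDimensional ℝ E]
  [CompleteSpace E]
  {M : Type*} [TopologicalSpace M] [T2Space M] [ChartedSpace E M] [IsManifold 𝓘(ℝ, E) ∞ M]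
  (A : AlmostHermitianStructure E M)

/-- The vector `w - √-1 Jw` of type `(1,0)` attached to a real tangent vector `w`. -/
def oneZero {x : M} (w : TangentSpace 𝓘(ℝ, E) x) : CTangent E x :=
  (1 : ℂ) ⊗ₜ[ℝ] w - Complex.I ⊗ₜ[ℝ] (A.J x w)

theorem oneZero_mem {x : M} (w : TangentSpace 𝓘(ℝ, E) x) : oneZero A w ∈ TOneZero A x := by
  rw [TOneZero, Module.End.mem_eigenspace_iff]
  simp only [oneZero, map_sub, LinearMap.baseChange_tmul, smul_sub, TensorProduct.smul_tmul',
    smul_eq_mul, mul_one, Complex.I_mul_I, ContinuousLinearMap.coe_coe, A.J_J,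
    TensorProduct.tmul_neg, TensorProduct.neg_tmul]
  abel

theorem exists_eq_oneZero {x : M} {X : CTangent E x} (hX : X ∈ TOneZero A x) :
    ∃ w, X = oneZero A w := by
  obtain ⟨a, b, rfl⟩ := exists_eq_add_I_tmul X
  refine ⟨(1 / 2 : ℝ) • (a + A.J x b), ?_⟩
  set X := (1 : ℂ) ⊗ₜ[ℝ] a + Complex.I ⊗ₜ[ℝ] b with hXdef
  rw [TOneZero, Module.End.mem_eigenspace_iff] at hX
  -- a vector `X` of type `(1,0)` equals `(X - √-1 JX) / 2`
  have h : (2 : ℂ) • X = X - Complex.I • ((A.J x).toLinearMap.baseChange ℂ) X := by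
    rw [hX, smul_smul, Complex.I_mul_I, two_smul]
    module
  have h2 : (2 : ℂ) • X = (2 : ℂ) • oneZero A ((1 / 2 : ℝ) • (a + A.J x b)) := by
    rw [h, hXdef]
    have e2 : ∀ (z : ℂ) (v : TangentSpace 𝓘(ℝ, E) x),
        (2 : ℂ) • (z ⊗ₜ[ℝ] ((1 / 2 : ℝ) • v)) = z ⊗ₜ[ℝ] v := fun z v ↦ by
      rw [← TensorProduct.smul_tmul, TensorProduct.smul_tmul']
      congr 1
      apply Complex.ext <;> simp
    simp only [oneZero, smul_sub, map_smul, e2]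
    simp only [map_add, LinearMap.baseChange_tmul, smul_add, TensorProduct.smul_tmul',
      smul_eq_mul, mul_one, Complex.I_mul_I, ContinuousLinearMap.coe_coe, A.J_J,
      TensorProduct.tmul_neg, TensorProduct.neg_tmul, TensorProduct.tmul_add]
    abel
  exact smul_right_injective _ (two_ne_zero' ℂ) h2

/-- The vanishing of the `(1,1)`-part of the torsion, in terms of real vectors. -/
theorem IsCanonicalConnection.torsion_add_torsion_J {A : AlmostHermitianStructure E M}
    {D : CovariantDerivative 𝓘(ℝ, E) E (TangentSpace 𝓘(ℝ, E) : M → Type _)}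
    (hD : IsCanonicalConnection A D) {x : M} (u v : TangentSpace 𝓘(ℝ, E) x) :
    D.torsion x u v + D.torsion x (A.J x u) (A.J x v) = 0 := by
  have h := congrArg (reC _)
    (hD.torsion_one_one x _ (oneZero_mem A u) _ (oneZero_mem A v))
  simpa [oneZero, conjC_tmul, reC_tmul, TensorProduct.smul_tmul'] using h

end Complexified

/-! ### Almost Hermitian structures in coordinates -/

section Local

variable {E : Type*} [NormedAddCommGroup E] [NormedSpace ℝ E] [FiniteDimensional ℝ E]
  [CompleteSpace E]
  {M : Type*} [TopologicalSpace M] [T2Space M] [ChartedSpace E M] [IsManifold 𝓘(ℝ, E) ∞ M]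
  (A : AlmostHermitianStructure E M) {x : M} {q : E}

/-- The coordinate expression of the metric in the preferred chart at `x`. -/
def localMetric (x : M) (q : E) : E →L[ℝ] E →L[ℝ] ℝ :=
  (ContinuousLinearMap.precomp ℝ (frameL x ((extChartAt 𝓘(ℝ, E) x).symm q))) ∘L
    (A.g.inner ((extChartAt 𝓘(ℝ, E) x).symm q)) ∘L (frameL x ((extChartAt 𝓘(ℝ, E) x).symm q))

theorem localMetric_apply (x : M) (q v w : E) :
    localMetric A x q v w = A.g.inner ((extChartAt 𝓘(ℝ, E) x).symm q)
      (frameL x ((extChartAt 𝓘(ℝ, E) x).symm q) v)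
      (frameL x ((extChartAt 𝓘(ℝ, E) x).symm q) w) := rfl

/-- The coordinate expression of the almost complex structure in the preferred chart at `x`. -/
def localJ (x : M) (q : E) : E →L[ℝ] E :=
  coordL x ((extChartAt 𝓘(ℝ, E) x).symm q) ∘L A.J ((extChartAt 𝓘(ℝ, E) x).symm q) ∘L
    frameL x ((extChartAt 𝓘(ℝ, E) x).symm q)

theorem localJ_apply (x : M) (q v : E) :
    localJ A x q v = coordL x ((extChartAt 𝓘(ℝ, E) x).symm q)
      (A.J ((extChartAt 𝓘(ℝ, E) x).symm q) (frameL x ((extChartAt 𝓘(ℝ, E) x).symm q) v)) := rfl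

theorem frameL_localJ (hq : q ∈ (extChartAt 𝓘(ℝ, E) x).target) (v : E) :
    frameL x ((extChartAt 𝓘(ℝ, E) x).symm q) (localJ A x q v) =
      A.J ((extChartAt 𝓘(ℝ, E) x).symm q) (frameL x ((extChartAt 𝓘(ℝ, E) x).symm q) v) := by
  rw [localJ_apply, frameL_coordL (symm_mem_source hq)]

theorem mdiffAt_J_frameL {y : M} (hy : y ∈ (chartAt E x).source) (v : E) :
    MDiffAt (T% fun z : M ↦ A.J z (frameL x z v)) y :=
  ((A.contMDiff_J y).mdifferentiableAt (by simp)).clm_bundle_apply (mdiffAt_frameL hy v)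

theorem contMDiffAt_inner_frameL {y : M} (hy : y ∈ (chartAt E x).source) (v w : E) :
    ContMDiffAt 𝓘(ℝ, E) 𝓘(ℝ, ℝ) ∞ (fun z ↦ A.g.inner z (frameL x z v) (frameL x z w)) y := by
  have h : ContMDiffAt 𝓘(ℝ, E) (𝓘(ℝ, E).prod 𝓘(ℝ, ℝ)) ∞
      (fun z ↦ TotalSpace.mk' ℝ (E := Bundle.Trivial M ℝ) z
        (A.g.inner z (frameL x z v) (frameL x z w))) y :=
    ContMDiffWithinAt.clm_bundle_apply₂ (F₁ := E) (F₂ := E)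
      (A.g.contMDiff y) (contMDiffAt_frameL hy v) (contMDiffAt_frameL hy w)
  exact (contMDiffAt_totalSpace.1 h).2

theorem IsCanonicalConnection.isLocalCanonical {A : AlmostHermitianStructure E M}
    {D : CovariantDerivative 𝓘(ℝ, E) E (TangentSpace 𝓘(ℝ, E) : M → Type _)}
    (hD : IsCanonicalConnection A D) (hq : q ∈ (extChartAt 𝓘(ℝ, E) x).target) :
    IsLocalCanonical (localMetric A x) (localJ A x) (christoffel D x) q := by
  have hy := symm_mem_source hq
  have hG : ContDiffAt ℝ 2 (localMetric A x) q :=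
    contDiffAt_clm_of_apply fun v ↦ contDiffAt_clm_of_apply fun w ↦
      (contDiffAt_comp_symm hq (contMDiffAt_inner_frameL A hy v w)).of_le
        (WithTop.coe_le_coe.2 le_top : ((2 : ℕ∞) : ℕ∞ω) ≤ ∞)
  have hJ : DifferentiableAt ℝ (localJ A x) q :=
    differentiableAt_clm_of_apply fun v ↦
      differentiableAt_comp_symm hq (mdiffAt_coordL hy (mdiffAt_J_frameL A hy v))
  refine ⟨hG, hJ, fun v w ↦ A.g.symm _ _ _, fun v ↦ ?_, fun v ↦ ?_, fun v w ↦ ?_,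
    fun u v w ↦ ?_, fun u v ↦ ?_, fun u v ↦ ?_⟩
  · rw [localMetric_apply]
    by_cases hv : frameL x ((extChartAt 𝓘(ℝ, E) x).symm q) v = 0
    · rw [hv, map_zero]
    · exact (A.g.pos _ _ hv).le
  · rw [localJ_apply, frameL_localJ A hq, A.J_J, map_neg, coordL_frameL hy]
  · rw [localMetric_apply, frameL_localJ A hq, frameL_localJ A hq, A.g_J_J, localMetric_apply]
  · have h1 := hD.parallel_g _ _ _ (mdiffAt_frameL hy v) (mdiffAt_frameL hy w)
      (frameL x ((extChartAt 𝓘(ℝ, E) x).symm q) u)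
    rw [← fderiv_comp_symm hq ((contMDiffAt_inner_frameL A hy v w).mdifferentiableAt (by simp))]
      at h1
    have h2 := fderiv_clm_apply₂_apply (hG.differentiableAt (by simp)) (differentiableAt_const v)
      (differentiableAt_const w) u
    simp only [fderiv_fun_const, Pi.zero_apply, zero_apply, map_zero, add_zero] at h2
    rw [← h2, localMetric_apply, localMetric_apply, christoffel_apply D hq,
      christoffel_apply D hq, frameL_coordL hy, frameL_coordL hy]
    exact h1
  · have h1 := congrArg (coordL x ((extChartAt 𝓘(ℝ, E) x).symm q))
      (hD.parallel_J _ _ (mdiffAt_frameL hy v) (frameL x ((extChartAt 𝓘(ℝ, E) x).symm q) u))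
    rw [coordL_cov D hq (mdiffAt_J_frameL A hy v)] at h1
    have h2 := fderiv_clm_apply_apply hJ (differentiableAt_const v) u
    simp only [fderiv_fun_const, Pi.zero_apply, zero_apply, map_zero, add_zero] at h2
    rw [← h2, christoffel_apply D hq u v, localJ_apply A x q (coordL _ _ _), frameL_coordL hy]
    exact h1
  · have h0 : ∀ a b : E, coordL x ((extChartAt 𝓘(ℝ, E) x).symm q)
        (D.torsion ((extChartAt 𝓘(ℝ, E) x).symm q)
          (frameL x ((extChartAt 𝓘(ℝ, E) x).symm q) a)
          (frameL x ((extChartAt 𝓘(ℝ, E) x).symm q) b)) =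
        christoffel D x q b a - christoffel D x q a b := by
      intro a b
      have h := D.torsion_apply (mdiffAt_frameL hy a) (mdiffAt_frameL hy b)
      rw [mlieBracket_frameL hy, sub_zero] at h
      rw [h, map_sub, christoffel_apply D hq, christoffel_apply D hq]
    have h1 := congrArg (coordL x ((extChartAt 𝓘(ℝ, E) x).symm q))
      (hD.torsion_add_torsion_J (frameL x ((extChartAt 𝓘(ℝ, E) x).symm q) u)
        (frameL x ((extChartAt 𝓘(ℝ, E) x).symm q) v))
    rw [← frameL_localJ A hq, ← frameL_localJ A hq, map_add, h0, h0, map_zero] at h1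
    exact h1

end Local

section Submanifold

variable {E : Type*} [NormedAddCommGroup E] [NormedSpace ℝ E] [FiniteDimensional ℝ E]
  [CompleteSpace E]
  {M : Type*} [TopologicalSpace M] [T2Space M] [ChartedSpace E M] [IsManifold 𝓘(ℝ, E) ∞ M]
  {A : AlmostHermitianStructure E M}
  {D : CovariantDerivative 𝓘(ℝ, E) E (TangentSpace 𝓘(ℝ, E) : M → Type _)}

theorem localMetric_extChartAt (A : AlmostHermitianStructure E M) {x y : M}
    (hy : y ∈ (chartAt E x).source) (v w : TangentSpace 𝓘(ℝ, E) y) :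
    localMetric A x (extChartAt 𝓘(ℝ, E) x y) (coordL x y v) (coordL x y w) =
      A.g.inner y v w := by
  rw [localMetric_apply, (extChartAt 𝓘(ℝ, E) x).left_inv (by simpa using hy), frameL_coordL hy,
    frameL_coordL hy]

theorem localJ_extChartAt (A : AlmostHermitianStructure E M) {x y : M}
    (hy : y ∈ (chartAt E x).source) (v : TangentSpace 𝓘(ℝ, E) y) :
    localJ A x (extChartAt 𝓘(ℝ, E) x y) (coordL x y v) = coordL x y (A.J y v) := by
  rw [localJ_apply, (extChartAt 𝓘(ℝ, E) x).left_inv (by simpa using hy), frameL_coordL hy]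

/-! ### Skew-symmetry of the curvature -/

section

variable [D.ContMDiffCovariantDerivative ∞]

theorem curvature_swap (x : M) (u v w : TangentSpace 𝓘(ℝ, E) x) :
    curvature D x u v w = -curvature D x v u w :=
  curvatureField_swap D _ _ _ x

/-- The curvature of a metric connection takes values in skew-adjoint endomorphisms. -/
theorem IsCanonicalConnection.inner_curvature_skew (hD : IsCanonicalConnection A D) {x : M}
    (u v w z : TangentSpace 𝓘(ℝ, E) x) :
    A.g.inner x (curvature D x u v w) z = -A.g.inner x (curvature D x u v z) w := by
  have hx := mem_chart_source E x
  rw [← localMetric_extChartAt A hx, ← localMetric_extChartAt A hx, coordL_curvature,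
    coordL_curvature]
  refine IsLocalCanonical.localCurv_skew (J := localJ A x) ?_
    (differentiableAt_christoffel D x) _ _ _ _
  filter_upwards [extChartAt_target_mem_nhds x] with q hq using hD.isLocalCanonical hq

end

/-! ### Pseudoholomorphic isometries in coordinates -/

variable {E' : Type*} [NormedAddCommGroup E'] [NormedSpace ℝ E'] [FiniteDimensional ℝ E']
  [CompleteSpace E']
  {M' : Type*} [TopologicalSpace M'] [T2Space M'] [ChartedSpace E' M'] [IsManifold 𝓘(ℝ, E') ∞ M']
  {A' : AlmostHermitianStructure E' M'}
  {D' : CovariantDerivative 𝓘(ℝ, E') E' (TangentSpace 𝓘(ℝ, E') : M' → Type _)}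
  {f : M → M'}

/-- The coordinate expression of `f` in the preferred charts at `x` and `f x`. -/
def localMap (E E' : Type*) [NormedAddCommGroup E] [NormedSpace ℝ E] [NormedAddCommGroup E']
    [NormedSpace ℝ E'] {M M' : Type*} [TopologicalSpace M] [ChartedSpace E M] [TopologicalSpace M']
    [ChartedSpace E' M'] (f : M → M') (x : M) (q : E) : E' :=
  extChartAt 𝓘(ℝ, E') (f x) (f ((extChartAt 𝓘(ℝ, E) x).symm q))

theorem localMap_extChartAt (f : M → M') (x : M) :
    localMap E E' f x (extChartAt 𝓘(ℝ, E) x x) = extChartAt 𝓘(ℝ, E') (f x) (f x) := by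
  rw [localMap, extChartAt_to_inv]

theorem contDiffAt_localMap (hf : ContMDiff 𝓘(ℝ, E) 𝓘(ℝ, E') ∞ f) {x : M} {q : E}
    (hq : q ∈ (extChartAt 𝓘(ℝ, E) x).target)
    (hfq : f ((extChartAt 𝓘(ℝ, E) x).symm q) ∈ (chartAt E' (f x)).source) :
    ContDiffAt ℝ ∞ (localMap E E' f x) q :=
  contDiffAt_comp_symm hq ((contMDiffAt_extChartAt' hfq).comp _ hf.contMDiffAt)

theorem fderiv_localMap (hf : ContMDiff 𝓘(ℝ, E) 𝓘(ℝ, E') ∞ f) {x : M} {q : E}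
    (hq : q ∈ (extChartAt 𝓘(ℝ, E) x).target)
    (hfq : f ((extChartAt 𝓘(ℝ, E) x).symm q) ∈ (chartAt E' (f x)).source) (v : E) :
    fderiv ℝ (localMap E E' f x) q v = coordL (f x) (f ((extChartAt 𝓘(ℝ, E) x).symm q))
      (mfderiv 𝓘(ℝ, E) 𝓘(ℝ, E') f ((extChartAt 𝓘(ℝ, E) x).symm q)
        (frameL x ((extChartAt 𝓘(ℝ, E) x).symm q) v)) := by
  have h1 : MDifferentiableAt 𝓘(ℝ, E') 𝓘(ℝ, E') (extChartAt 𝓘(ℝ, E') (f x))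
      (f ((extChartAt 𝓘(ℝ, E) x).symm q)) := mdifferentiableAt_extChartAt hfq
  have h2 : MDifferentiableAt 𝓘(ℝ, E) 𝓘(ℝ, E') f ((extChartAt 𝓘(ℝ, E) x).symm q) :=
    hf.mdifferentiable (by simp) _
  have h := fderiv_comp_symm hq (h1.comp _ h2) v
  rw [coordL_eq_mfderiv hfq]
  refine h.trans ?_
  exact congrArg (fun L : TangentSpace 𝓘(ℝ, E) ((extChartAt 𝓘(ℝ, E) x).symm q) →L[ℝ] E' ↦
    L (frameL x ((extChartAt 𝓘(ℝ, E) x).symm q) v)) (mfderiv_comp _ h1 h2)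

theorem fderiv_localMap_extChartAt (hf : ContMDiff 𝓘(ℝ, E) 𝓘(ℝ, E') ∞ f) (x : M)
    (v : TangentSpace 𝓘(ℝ, E) x) :
    fderiv ℝ (localMap E E' f x) (extChartAt 𝓘(ℝ, E) x x) (coordL x x v) =
      coordL (f x) (f x) (mfderiv 𝓘(ℝ, E) 𝓘(ℝ, E') f x v) := by
  rw [fderiv_localMap hf (mem_extChartAt_target x) (by rw [extChartAt_to_inv]; simp),
    extChartAt_to_inv, frameL_coordL (mem_chart_source E x)]

theorem IsPseudoholomorphicIsometry.eventually_isLocalIsometry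
    (hf : IsPseudoholomorphicIsometry A A' f) (hD : IsCanonicalConnection A D)
    (hD' : IsCanonicalConnection A' D') (x : M) :
    ∀ᶠ q in 𝓝 (extChartAt 𝓘(ℝ, E) x x), IsLocalIsometry (localMetric A x) (localJ A x)
      (christoffel D x) (localMetric A' (f x)) (localJ A' (f x)) (christoffel D' (f x))
      (localMap E E' f x) q := by
  have h1 : ∀ᶠ q in 𝓝 (extChartAt 𝓘(ℝ, E) x x), q ∈ (extChartAt 𝓘(ℝ, E) x).target ∧
      f ((extChartAt 𝓘(ℝ, E) x).symm q) ∈ (chartAt E' (f x)).source := by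
    refine Filter.Eventually.and (extChartAt_target_mem_nhds x) ?_
    have hc : ContinuousAt (fun q ↦ f ((extChartAt 𝓘(ℝ, E) x).symm q))
        (extChartAt 𝓘(ℝ, E) x x) :=
      hf.contMDiff.continuous.continuousAt.comp (continuousAt_extChartAt_symm x)
    refine hc.eventually_mem ?_
    rw [extChartAt_to_inv]
    exact (chartAt E' (f x)).open_source.mem_nhds (mem_chart_source E' (f x))
  filter_upwards [h1.eventually_nhds] with q hq
  obtain ⟨hq1, hq2⟩ := hq.self_of_nhds
  refine ⟨(contDiffAt_localMap hf.contMDiff hq1 hq2).of_le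
    (WithTop.coe_le_coe.2 le_top : ((3 : ℕ∞) : ℕ∞ω) ≤ ∞), hD.isLocalCanonical hq1,
    hD'.isLocalCanonical ((extChartAt 𝓘(ℝ, E') (f x)).map_source (by simpa using hq2)), ?_, ?_⟩
  · filter_upwards [hq] with p hp v w
    rw [fderiv_localMap hf.contMDiff hp.1 hp.2, fderiv_localMap hf.contMDiff hp.1 hp.2, localMap,
      localMetric_extChartAt A' hp.2, hf.isometry, localMetric_apply]
  · filter_upwards [hq] with p hp v
    rw [fderiv_localMap hf.contMDiff hp.1 hp.2, fderiv_localMap hf.contMDiff hp.1 hp.2,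
      frameL_localJ A hp.1, hf.pseudoholomorphic, localMap, localJ_extChartAt A' hp.2]

/-- The curvature-decreasing property of pseudoholomorphic isometries, in terms of real vectors. -/
theorem IsPseudoholomorphicIsometry.inner_curvature_le [D.ContMDiffCovariantDerivative ∞]
    [D'.ContMDiffCovariantDerivative ∞] (hf : IsPseudoholomorphicIsometry A A' f)
    (hD : IsCanonicalConnection A D) (hD' : IsCanonicalConnection A' D') (x : M)
    (u w : TangentSpace 𝓘(ℝ, E) x) :
    A'.g.inner (f x) (curvature D' (f x) (mfderiv 𝓘(ℝ, E) 𝓘(ℝ, E') f x u)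
        (A'.J (f x) (mfderiv 𝓘(ℝ, E) 𝓘(ℝ, E') f x u)) (mfderiv 𝓘(ℝ, E) 𝓘(ℝ, E') f x w))
        (A'.J (f x) (mfderiv 𝓘(ℝ, E) 𝓘(ℝ, E') f x w)) ≤
      A.g.inner x (curvature D x u (A.J x u) w) (A.J x w) := by
  have hx := mem_chart_source E x
  have hx' := mem_chart_source E' (f x)
  have key := IsLocalIsometry.bisectional_le (hf.eventually_isLocalIsometry hD hD' x)
    (differentiableAt_christoffel D x)
    (by rw [localMap_extChartAt]; exact differentiableAt_christoffel D' (f x))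
    (coordL x x u) (coordL x x w)
  rw [localJ_extChartAt A hx, localJ_extChartAt A hx] at key
  simp only [fderiv_localMap_extChartAt hf.contMDiff] at key
  rw [localMap_extChartAt, ← coordL_curvature, ← coordL_curvature, localMetric_extChartAt A' hx',
    localMetric_extChartAt A hx, hf.pseudoholomorphic, hf.pseudoholomorphic] at key
  exact key

end Submanifold

/-! ### Symmetries of the complexified curvature -/

section Complex

variable {E : Type*} [NormedAddCommGroup E] [NormedSpace ℝ E] [FiniteDimensional ℝ E]
  [CompleteSpace E]
  {M : Type*} [TopologicalSpace M] [T2Space M] [ChartedSpace E M] [IsManifold 𝓘(ℝ, E) ∞ M]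
  {A : AlmostHermitianStructure E M}
  {D : CovariantDerivative 𝓘(ℝ, E) E (TangentSpace 𝓘(ℝ, E) : M → Type _)}
  {x : M}

theorem herm_tmul (a b : ℂ) (v w : TangentSpace 𝓘(ℝ, E) x) :
    herm A (a ⊗ₜ v) (b ⊗ₜ w) = a * conj b * A.g.inner x v w := by
  simp [herm, gC, conjC_tmul, LinearMap.BilinForm.baseChange_tmul]
  ring

theorem herm_add_left (X X' Y : CTangent E x) :
    herm A (X + X') Y = herm A X Y + herm A X' Y := by
  simp [herm]

theorem herm_add_right (X Y Y' : CTangent E x) :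
    herm A X (Y + Y') = herm A X Y + herm A X Y' := by
  simp [herm]

theorem herm_zero_left (Y : CTangent E x) : herm A 0 Y = 0 := by
  simp [herm]

theorem herm_zero_right (X : CTangent E x) : herm A X 0 = 0 := by
  simp [herm]

theorem herm_conj (X Y : CTangent E x) : herm A Y X = conj (herm A X Y) := by
  induction X using TensorProduct.induction_on with
  | zero => rw [herm_zero_left, herm_zero_right, map_zero]
  | add X X' h h' => rw [herm_add_left, herm_add_right, h, h', map_add]
  | tmul a v =>
    induction Y using TensorProduct.induction_on with
    | zero => rw [herm_zero_left, herm_zero_right, map_zero]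
    | add X X' h h' => rw [herm_add_left, herm_add_right, h, h', map_add]
    | tmul b w =>
      rw [herm_tmul, herm_tmul, A.g.symm]
      simp only [map_mul, Complex.conj_conj, Complex.conj_ofReal]
      ring

theorem herm_oneZero (w : TangentSpace 𝓘(ℝ, E) x) :
    herm A (oneZero A w) (oneZero A w) = ((2 * A.g.inner x w w : ℝ) : ℂ) := by
  have h := A.g_J_J x w w
  have h2 := A.g.symm x w (A.J x w)
  simp only [oneZero, sub_eq_add_neg, ← TensorProduct.neg_tmul, herm_add_left, herm_add_right,
    herm_tmul, h, h2]
  apply Complex.ext <;> simp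
  ring

variable [D.ContMDiffCovariantDerivative ∞]

theorem curv_tmul (a b c d : ℂ) (u v w z : TangentSpace 𝓘(ℝ, E) x) :
    curv A D (a ⊗ₜ u) (b ⊗ₜ v) (c ⊗ₜ w) (d ⊗ₜ z) =
      c * conj d * a * conj b * A.g.inner x (curvature D x w z u) v := by
  rw [curv, conjC_tmul, complexify₃_tmul, herm_tmul]

theorem curv_add₁ (X X' Y Z W : CTangent E x) :
    curv A D (X + X') Y Z W = curv A D X Y Z W + curv A D X' Y Z W := by
  simp [curv, herm_add_left]

theorem curv_add₂ (X Y Y' Z W : CTangent E x) :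
    curv A D X (Y + Y') Z W = curv A D X Y Z W + curv A D X Y' Z W := by
  simp [curv, herm_add_right]

theorem curv_add₃ (X Y Z Z' W : CTangent E x) :
    curv A D X Y (Z + Z') W = curv A D X Y Z W + curv A D X Y Z' W := by
  simp [curv, complexify₃, herm_add_left]

theorem curv_add₄ (X Y Z W W' : CTangent E x) :
    curv A D X Y Z (W + W') = curv A D X Y Z W + curv A D X Y Z W' := by
  simp [curv, complexify₃, herm_add_left]

theorem curv_zero₁ (Y Z W : CTangent E x) : curv A D 0 Y Z W = 0 := by
  simp [curv, herm_zero_left]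

theorem curv_zero₂ (X Z W : CTangent E x) : curv A D X 0 Z W = 0 := by
  simp [curv, herm_zero_right]

theorem curv_zero₃ (X Y W : CTangent E x) : curv A D X Y 0 W = 0 := by
  simp [curv, complexify₃, herm_zero_left]

theorem curv_zero₄ (X Y Z : CTangent E x) : curv A D X Y Z 0 = 0 := by
  simp [curv, complexify₃, herm_zero_left]

theorem IsCanonicalConnection.curv_conj (hD : IsCanonicalConnection A D)
    (X Y Z W : CTangent E x) : curv A D Y X W Z = conj (curv A D X Y Z W) := by
  induction X using TensorProduct.induction_on with
  | zero => rw [curv_zero₁, curv_zero₂, map_zero]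
  | add X X' h h' => rw [curv_add₁, curv_add₂, h, h', map_add]
  | tmul a u =>
  induction Y using TensorProduct.induction_on with
  | zero => rw [curv_zero₁, curv_zero₂, map_zero]
  | add X X' h h' => rw [curv_add₁, curv_add₂, h, h', map_add]
  | tmul b v =>
  induction Z using TensorProduct.induction_on with
  | zero => rw [curv_zero₃, curv_zero₄, map_zero]
  | add X X' h h' => rw [curv_add₃, curv_add₄, h, h', map_add]
  | tmul c w =>
  induction W using TensorProduct.induction_on with
  | zero => rw [curv_zero₃, curv_zero₄, map_zero]
  | add X X' h h' => rw [curv_add₃, curv_add₄, h, h', map_add]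
  | tmul d z =>
    rw [curv_tmul, curv_tmul, curvature_swap, map_neg, neg_apply, hD.inner_curvature_skew, neg_neg]
    simp only [map_mul, Complex.conj_conj, Complex.conj_ofReal]
    ring

theorem IsCanonicalConnection.curv_oneZero (hD : IsCanonicalConnection A D)
    (w u : TangentSpace 𝓘(ℝ, E) x) :
    curv A D (oneZero A w) (oneZero A w) (oneZero A u) (oneZero A u) =
      ((-4 * A.g.inner x (curvature D x u (A.J x u) w) (A.J x w) : ℝ) : ℂ) := by
  have h1 : ∀ a b : TangentSpace 𝓘(ℝ, E) x, curvature D x a a b = 0 := fun a b ↦ by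
    have h := curvature_swap (D := D) x a a b
    have h2 : (2 : ℝ) • curvature D x a a b = 0 := by
      rw [two_smul]
      exact add_eq_zero_iff_eq_neg.2 h
    exact (smul_eq_zero_iff_right (two_ne_zero' ℝ)).1 h2
  have h2 : ∀ a, A.g.inner x (curvature D x u (A.J x u) a) a = 0 := fun a ↦ by
    have h := hD.inner_curvature_skew u (A.J x u) a a
    linarith
  have h3 : curvature D x (A.J x u) u = -curvature D x u (A.J x u) :=
    LinearMap.ext fun a ↦ curvature_swap x _ _ a
  have h4 := hD.inner_curvature_skew u (A.J x u) (A.J x w) w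
  simp only [oneZero, sub_eq_add_neg, ← TensorProduct.neg_tmul, curv_add₁, curv_add₂, curv_add₃,
    curv_add₄, curv_tmul, h1, h3, LinearMap.neg_apply, map_neg, neg_apply, h2, h4, map_zero,
    zero_apply]
  apply Complex.ext <;> simp
  ring

end Complex

/-! ### Comparison of bisectional curvatures -/

section Comparison

variable {E : Type*} [NormedAddCommGroup E] [NormedSpace ℝ E] [FiniteDimensional ℝ E]
  [CompleteSpace E]
  {M : Type*} [TopologicalSpace M] [T2Space M] [ChartedSpace E M] [IsManifold 𝓘(ℝ, E) ∞ M]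
  {A : AlmostHermitianStructure E M}
  {D : CovariantDerivative 𝓘(ℝ, E) E (TangentSpace 𝓘(ℝ, E) : M → Type _)}
  [D.ContMDiffCovariantDerivative ∞]

theorem HBLe.inner_curvature_le {B : ℝ} (hB : HBLe A D B) (hD : IsCanonicalConnection A D)
    {x : M} {u w : TangentSpace 𝓘(ℝ, E) x} (hu : u ≠ 0) (hw : w ≠ 0) :
    -A.g.inner x (curvature D x u (A.J x u) w) (A.J x w) ≤
      B * (A.g.inner x w w * A.g.inner x u u) := by
  have hne : ∀ v : TangentSpace 𝓘(ℝ, E) x, v ≠ 0 → oneZero A v ≠ 0 := fun v hv h0 ↦ by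
    have h := herm_oneZero (A := A) v
    rw [h0, herm_zero_left] at h
    have h2 : (2 * A.g.inner x v v : ℝ) = 0 := by exact_mod_cast h.symm
    have := A.g.pos x v hv
    linarith
  have h := hB x _ (oneZero_mem A w) _ (oneZero_mem A u) (hne w hw) (hne u hu)
  have hpos : 0 < 2 * A.g.inner x w w * (2 * A.g.inner x u u) := by
    have := A.g.pos x w hw
    have := A.g.pos x u hu
    positivity
  rw [HB, hD.curv_oneZero, herm_oneZero, herm_oneZero, ← Complex.ofReal_mul,
    ← Complex.ofReal_div, Complex.ofReal_re, div_le_iff₀ hpos] at h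
  linarith

variable {E' : Type*} [NormedAddCommGroup E'] [NormedSpace ℝ E'] [FiniteDimensional ℝ E']
  [CompleteSpace E']
  {M' : Type*} [TopologicalSpace M'] [T2Space M'] [ChartedSpace E' M'] [IsManifold 𝓘(ℝ, E') ∞ M']
  {A' : AlmostHermitianStructure E' M'}
  {D' : CovariantDerivative 𝓘(ℝ, E') E' (TangentSpace 𝓘(ℝ, E') : M' → Type _)}
  [D'.ContMDiffCovariantDerivative ∞] {f : M → M'}

/-- An upper bound for the bisectional curvature of the target is one for the source. It is stated
without denominators, so that vanishing vectors need no separate treatment; the order is the one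
of `ℂ`, so that the statement includes that the left-hand side is real. -/
theorem IsPseudoholomorphicIsometry.curv_le (hf : IsPseudoholomorphicIsometry A A' f)
    (hD : IsCanonicalConnection A D) (hD' : IsCanonicalConnection A' D') {B : ℝ}
    (hB : HBLe A' D' B) {x : M} {X Y : CTangent E x} (hX : X ∈ TOneZero A x)
    (hY : Y ∈ TOneZero A x) :
    curv A D X X Y Y ≤ (B : ℂ) * (herm A X X * herm A Y Y) := by
  obtain ⟨w, rfl⟩ := exists_eq_oneZero A hX
  obtain ⟨u, rfl⟩ := exists_eq_oneZero A hY
  rw [hD.curv_oneZero, herm_oneZero, herm_oneZero, ← Complex.ofReal_mul, ← Complex.ofReal_mul,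
    Complex.real_le_real]
  by_cases hw : w = 0
  · simp [hw]
  by_cases hu : u = 0
  · simp [hu]
  have hinj : ∀ v : TangentSpace 𝓘(ℝ, E) x, v ≠ 0 → mfderiv 𝓘(ℝ, E) 𝓘(ℝ, E') f x v ≠ 0 :=
    fun v hv h0 ↦ by
      have h := hf.isometry x v v
      rw [h0, map_zero] at h
      exact (A.g.pos x v hv).ne h
  have h1 := hB.inner_curvature_le hD' (hinj u hu) (hinj w hw)
  have h2 := hf.inner_curvature_le hD hD' x u w
  rw [hf.isometry, hf.isometry] at h1
  linarith

end Comparison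

end AlmostHermitian

end

theorem proposition6p1 {m n : ℕ}
    {M : Type*} [TopologicalSpace M] [T2Space M]
    [ChartedSpace (EuclideanSpace ℝ (Fin (2 * m))) M] [IsManifold (𝓡 (2 * m)) ∞ M]
    {M' : Type*} [TopologicalSpace M'] [T2Space M']
    [ChartedSpace (EuclideanSpace ℝ (Fin (2 * n))) M'] [IsManifold (𝓡 (2 * n)) ∞ M']
    (A : AlmostHermitian.AlmostHermitianStructure (EuclideanSpace ℝ (Fin (2 * m))) M)
    (A' : AlmostHermitian.AlmostHermitianStructure (EuclideanSpace ℝ (Fin (2 * n))) M')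
    (D : CovariantDerivative (𝓡 (2 * m)) (EuclideanSpace ℝ (Fin (2 * m)))
      (TangentSpace (𝓡 (2 * m)) : M → Type _))
    [D.ContMDiffCovariantDerivative ∞] (hD : AlmostHermitian.IsCanonicalConnection A D)
    (D' : CovariantDerivative (𝓡 (2 * n)) (EuclideanSpace ℝ (Fin (2 * n)))
      (TangentSpace (𝓡 (2 * n)) : M' → Type _))
    [D'.ContMDiffCovariantDerivative ∞] (hD' : AlmostHermitian.IsCanonicalConnection A' D')
    (B : ℝ) (hB : AlmostHermitian.HBLe A' D' B)
    (f : M → M') (hf : AlmostHermitian.IsPseudoholomorphicIsometry A A' f) :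
    (∀ (x : M) (e : Fin m → AlmostHermitian.CTangent (EuclideanSpace ℝ (Fin (2 * m))) x),
      AlmostHermitian.IsUnitaryFrame A e →
        AlmostHermitian.IsNegSemidef A (fun X Y ↦
          AlmostHermitian.ricci₁ A D e X Y - (m : ℂ) * B * AlmostHermitian.herm A X Y) ∧
        AlmostHermitian.IsNegSemidef A (fun X Y ↦
          AlmostHermitian.ricci₂ A D e X Y - (m : ℂ) * B * AlmostHermitian.herm A X Y) ∧
        AlmostHermitian.scalar A D e ≤ (m : ℂ) ^ 2 * B) ∧
    ∀ x : M, ∀ X ∈ AlmostHermitian.TOneZero A x, X ≠ 0 → AlmostHermitian.HS A D X ≤ (B : ℂ) := by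
  have key := fun {x : M} {X Y : AlmostHermitian.CTangent (EuclideanSpace ℝ (Fin (2 * m))) x}
    (hX : X ∈ AlmostHermitian.TOneZero A x) (hY : Y ∈ AlmostHermitian.TOneZero A x) ↦
      hf.curv_le hD hD' hB hX hY
  refine ⟨fun x e he ↦ ⟨⟨fun X _ Y _ ↦ ?_, fun X hX ↦ ?_⟩, ⟨fun X _ Y _ ↦ ?_, fun X hX ↦ ?_⟩, ?_⟩,
    fun x X hX hX0 ↦ ?_⟩
  · simp only [AlmostHermitian.ricci₁, map_sub, map_mul, map_sum, ← hD.curv_conj,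
      ← AlmostHermitian.herm_conj, Complex.conj_ofReal, Complex.conj_natCast]
  · rw [sub_nonpos]
    calc _ ≤ ∑ i : Fin m, (B : ℂ) * AlmostHermitian.herm A X X :=
          Finset.sum_le_sum fun i _ ↦ by simpa [he.unitary] using key (he.mem i) hX
      _ = _ := by simp [mul_assoc]
  · simp only [AlmostHermitian.ricci₂, map_sub, map_mul, map_sum, ← hD.curv_conj,
      ← AlmostHermitian.herm_conj, Complex.conj_ofReal, Complex.conj_natCast]
  · rw [sub_nonpos]
    calc _ ≤ ∑ i : Fin m, (B : ℂ) * AlmostHermitian.herm A X X :=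
          Finset.sum_le_sum fun i _ ↦ by simpa [he.unitary] using key hX (he.mem i)
      _ = _ := by simp [mul_assoc]
  · calc _ ≤ ∑ i : Fin m, ∑ j : Fin m, (B : ℂ) :=
          Finset.sum_le_sum fun i _ ↦ Finset.sum_le_sum fun j _ ↦ by
            simpa [he.unitary] using key (he.mem i) (he.mem j)
      _ = _ := by simp [pow_two, mul_assoc]
  · obtain ⟨w, rfl⟩ := AlmostHermitian.exists_eq_oneZero A hX
    have hw : w ≠ 0 := by
      rintro rfl
      exact hX0 (by simp [AlmostHermitian.oneZero])
    have hpos : 0 < 2 * A.g.inner x w w * (2 * A.g.inner x w w) := by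
      have := A.g.pos x w hw
      positivity
    have h := key hX hX
    rw [AlmostHermitian.HS, pow_two]
    rw [hD.curv_oneZero, AlmostHermitian.herm_oneZero] at h ⊢
    rw [← Complex.ofReal_mul, ← Complex.ofReal_mul, Complex.real_le_real] at h
    rw [← Complex.ofReal_mul, ← Complex.ofReal_div, Complex.real_le_real, div_le_iff₀ hpos]
    exact h
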